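/- **Setting.** Let $\Lambda$ be an integrally closed domain, $G$ a finite subgroup of $\operatorname{Aut}(\Lambda)$ and $\mathscr{M}$ a submonoid of $\operatorname{Aut}(\Lambda)$ (ring automorphisms under composition) such that (A1) $(\mathscr{M}\mathscr{M}^{-1})\cap G=\{1\}$; (A2) ${}^g\mu := g\circ\mu\circ g^{-1}\in\mathscr{M}$ for all $g\in G$, $\mu\in\mathscr{M}$; (A3) $\Lambda$ is a noetherian $\Lambda^G$-module. Put $L=\operatorname{Frac}\Lambda$, and let $\mathscr{L}=L*\mathscr{M}$ be the skew monoid ring: the free left $L$-module on $\mathscr{M}$ with multiplication $(a_1\mu_1)(a_2\mu_2)=\big(a_1\mu_1(a_2)\big)\mu_1\mu_2$. The group $G$ acts on $\mathscr{L}$ by ring automorphisms, $g(a\mu)=g(a)\,{}^g\mu$. Put $\Gamma=\Lambda^G$, $K=L^G$, $\mathscr{K}=\mathscr{L}^G$. For $X=\sum_\mu x_\mu\mu\in\mathscr{L}$ let $\operatorname{Supp}(X)=\{\mu\mid x_\mu\ne0\}$, and for $a\in L$ let $X(a)=\sum_\mu x_\mu\,\mu(a)\in L$. A subring $\mathscr{U}$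 with $\Gamma\subseteq\mathscr{U}\subseteq\mathscr{K}$ is a *Galois $\Gamma$-ring in $\mathscr{K}$* if $\mathscr{U}K=\mathscr{K}=K\mathscr{U}$, and a *Galois $\Gamma$-order in $\mathscr{K}$* if moreover, for every finite-dimensional left (respectively right) $K$-subspace $W\subseteq\mathscr{K}$, the intersection $W\cap\mathscr{U}$ is a finitely generated left (respectively right) $\Gamma$-module. A commutative subring is *maximal commutative* in a ring if it is not properly contained in any commutative subring. **Theorem.** Let $\mathscr{X}\subseteq\mathscr{K}$ be a set such that $\bigcup_{X\in\mathscr{X}}\operatorname{Supp}(X)$ generates $\mathscr{M}$ as a monoid and $X(\gamma)\in\Gamma$ for all $X\in\mathscr{X}$, $\gamma\in\Gamma$. Let $\mathscr{U}$ be the subring of $\mathscr{K}$ generated by $\Gamma\cup\mathscr{X}$. Then (i) $\mathscr{U}$ is a Galois $\Gamma$-order in $\mathscr{K}$; (ii) $\Gamma$ is maximal commutative in $\mathscr{U}$. (iii) Suppose in addition that $\Lambda$ is a finitely generated algebra over an algebraically closed field $\Bbbk$ of characteristic $0$ and that $G$ and $\mathscr{M}$ act on $\Lambda$ by $\Bbbk$-algebra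 automorphisms. Then $u(\gamma)\in\Gamma$ for all $u\in\mathscr{U}$, $\gamma\in\Gamma$, so $\Gamma^*=\operatorname{Hom}_\Bbbk(\Gamma,\Bbbk)$ is a right $\mathscr{U}$-module via $(\tau u)(\gamma)=\tau(u(\gamma))$. For every $\Bbbk$-algebra homomorphism $\xi:\Gamma\to\Bbbk$, the cyclic submodule $\xi\,\mathscr{U}\subseteq\Gamma^*$ has a unique simple quotient $V(\xi)$: the quotient $V(\xi)$ of $\xi\,\mathscr{U}$ by the sum of all its proper submodules is simple, and the kernel of any simple quotient of $\xi\,\mathscr{U}$ equals that sum. Moreover $V(\xi)$ is a Gelfand–Zeitlin module, i.e. $v\Gamma$ is a finite-dimensional $\Bbbk$-vector space for each $v\in V(\xi)$, and its generalized weight space $V(\xi)_\xi=\{v\in V(\xi)\mid v(\ker\xi)^N=0 \text{ for } N\gg0\}$ is nonzero. -/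

import Mathlib

open MulOpposite

noncomputable section

namespace GaloisOrder

universe u v w

section Setting

variable {Λ : Type u} [CommRing Λ]

/-- The subring `Λ^G` of invariants of a group `G` of ring automorphisms of `Λ`. -/
abbrev invariants (G : Subgroup (RingAut Λ)) : Subring Λ := FixedPoints.subring Λ G

/-- A finite group `G` and a monoid `M` of automorphisms of `Λ`, subject to the three standing
assumptions: separation `(M M⁻¹) ∩ G = 1`, invariance of `M` under conjugation by `G`, and
finiteness (`Λ` is a noetherian `Λ^G`-module). The product in `RingAut Λ` is composition. -/
structure Datum (Λ : Type u) [CommRing Λ] where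
  /-- the finite group `G` -/
  G : Subgroup (RingAut Λ)
  /-- the monoid `M` -/
  M : Submonoid (RingAut Λ)
  finite_G : Finite G
  separation : ∀ μ ∈ M, ∀ ν ∈ M, μ * ν⁻¹ ∈ G → μ * ν⁻¹ = 1
  invariance : ∀ g ∈ G, ∀ μ ∈ M, g * μ * g⁻¹ ∈ M
  noetherian : IsNoetherian (invariants G) Λ

end Setting

/-- A commutative subring `C` of `A` is maximal commutative in `A` if it is not properly contained
in any commutative subring of `A`. (Both are given as subrings of an ambient ring `R`.) -/
def IsMaximalCommutative {R : Type*} [Ring R] (C A : Subring R) : Prop :=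
  C ≤ A ∧ (∀ x ∈ C, ∀ y ∈ C, x * y = y * x) ∧
    ∀ D : Subring R, D ≤ A → (∀ x ∈ D, ∀ y ∈ D, x * y = y * x) → C ≤ D → D = C

variable {Λ : Type u} [CommRing Λ] [IsDomain Λ]

/-- The field of fractions `L = Frac Λ`. -/
def Frac (Λ : Type u) [CommRing Λ] [IsDomain Λ] : Type u := FractionRing Λ

instance : Field (Frac Λ) := inferInstanceAs (Field (FractionRing Λ))

instance : Algebra Λ (Frac Λ) := inferInstanceAs (Algebra Λ (FractionRing Λ))

instance : IsFractionRing Λ (Frac Λ) := inferInstanceAs (IsFractionRing Λ (FractionRing Λ))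

/-- The natural action of `Aut(Λ)` on the field of fractions of `Λ`. -/
instance fracAction : MulSemiringAction (RingAut Λ) (Frac Λ) :=
  IsFractionRing.mulSemiringAction (RingAut Λ) Λ (Frac Λ)

lemma smul_algebraMap_frac (σ : RingAut Λ) (a : Λ) :
    σ • algebraMap Λ (Frac Λ) a = algebraMap Λ (Frac Λ) (σ a) :=
  IsFractionRing.ringEquivOfRingEquiv_algebraMap σ a

namespace Datum

variable (S : Datum Λ)

/-- `Γ = Λ^G`. -/
abbrev Γ : Subring Λ := invariants S.G

/-- `K = L^G`, where `L = Frac Λ`. -/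
abbrev K : Subfield (Frac Λ) := FixedPoints.subfield S.G (Frac Λ)

/-- The skew monoid ring `L ∗ M`, with `(a μ) (b ν) = (a μ(b)) (μ ν)`. -/
abbrev 𝓛 : Type u := SkewMonoidAlgebra (Frac Λ) S.M

/-- The embedding `L → L ∗ M`, `a ↦ a 1`. -/
abbrev coeffHom : Frac Λ →+* S.𝓛 := SkewMonoidAlgebra.singleOneRingHom

/-- Conjugation `μ ↦ g μ g⁻¹` of `M` by an element of `G`. -/
def conj (g : S.G) : S.M →* S.M where
  toFun μ := ⟨(g : RingAut Λ) * μ * (g : RingAut Λ)⁻¹, S.invariance g g.2 μ μ.2⟩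
  map_one' := by ext1; simp
  map_mul' μ ν := by ext1; simp [mul_assoc]

/-- The ring endomorphism `a μ ↦ g(a) (g μ g⁻¹)` of `L ∗ M`. -/
def skewAut (g : S.G) : S.𝓛 →+* S.𝓛 :=
  SkewMonoidAlgebra.liftNCRingHom
    (S.coeffHom.comp (MulSemiringAction.toRingHom S.G (Frac Λ) g))
    ((SkewMonoidAlgebra.of (Frac Λ) S.M).comp (S.conj g))
    (by
      intro x y
      have h : g • y • x = (S.conj g y) • g • x := by
        change (g : RingAut Λ) • (y : RingAut Λ) • x =
          ((g : RingAut Λ) * y * (g : RingAut Λ)⁻¹) • (g : RingAut Λ) • x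
        simp [mul_smul]
      simp [SkewMonoidAlgebra.singleOneRingHom, SkewMonoidAlgebra.single_mul_single, h])

lemma skewAut_single (g : S.G) (μ : S.M) (a : Frac Λ) :
    S.skewAut g (SkewMonoidAlgebra.single μ a) =
      SkewMonoidAlgebra.single (S.conj g μ) (g • a) := by
  simp [skewAut, SkewMonoidAlgebra.liftNCRingHom, SkewMonoidAlgebra.singleOneRingHom,
    SkewMonoidAlgebra.single_mul_single]

/-- The action of `G` on `L ∗ M`. -/
def skewAction : S.G →* (S.𝓛 →+* S.𝓛) where
  toFun := S.skewAut
  map_one' := by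
    refine RingHom.ext fun X => ?_
    induction X using SkewMonoidAlgebra.induction_on with
    | zero => simp
    | single μ x => simp [skewAut_single, conj]
    | add X Y hX hY => rw [map_add, map_add, hX, hY]
  map_mul' g h := by
    refine RingHom.ext fun X => ?_
    induction X using SkewMonoidAlgebra.induction_on with
    | zero => simp
    | single μ x => simp [skewAut_single, conj, mul_smul, mul_assoc]
    | add X Y hX hY => rw [map_add, map_add, hX, hY]

/-- The subring `(L ∗ M)^G` of invariants. -/
def 𝒦 : Subring S.𝓛 where
  carrier := {X | ∀ g : S.G, S.skewAction g X = X}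
  mul_mem' hX hY g := by rw [map_mul, hX g, hY g]
  one_mem' g := map_one _
  add_mem' hX hY g := by rw [map_add, hX g, hY g]
  zero_mem' g := map_zero _
  neg_mem' hX g := by rw [map_neg, hX g]

/-- The embedding of `Γ` into `L ∗ M`. -/
def gammaHom : S.Γ →+* S.𝓛 :=
  (S.coeffHom.comp (algebraMap Λ (Frac Λ))).comp S.Γ.subtype

/-- `Γ` as a subring of `L ∗ M`. -/
def ΓSub : Subring S.𝓛 := S.gammaHom.range

/-- `K` as a subring of `L ∗ M`. -/
def KSub : Subring S.𝓛 := S.K.toSubring.map S.coeffHom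

/-- The evaluation `X(a) = ∑ x_μ μ(a)` of `X = ∑ x_μ μ` at `a ∈ L`. -/
def eval (X : S.𝓛) (a : Frac Λ) : Frac Λ :=
  X.sum fun μ x => x * (μ • a)

/-- Evaluation, as a ring homomorphism. -/
def evalHom : S.𝓛 →+* AddMonoid.End (Frac Λ) :=
  SkewMonoidAlgebra.liftNCRingHom
    (Module.toAddMonoidEnd (Frac Λ) (Frac Λ))
    (DistribMulAction.toAddMonoidEnd S.M (Frac Λ))
    (by
      intro x μ
      ext a
      exact (smul_mul' μ x a).symm)

lemma evalHom_apply (X : S.𝓛) (a : Frac Λ) : S.evalHom X a = S.eval X a := by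
  induction X using SkewMonoidAlgebra.induction_on with
  | zero => simp [eval]
  | single μ x =>
    simp only [eval, evalHom, SkewMonoidAlgebra.liftNCRingHom, RingHom.coe_mk, MonoidHom.coe_mk,
      OneHom.coe_mk, AddMonoidHom.toFun_eq_coe, SkewMonoidAlgebra.liftNC_single]
    rw [SkewMonoidAlgebra.sum_single_index (zero_mul _)]
    rfl
  | add X Y hX hY =>
    rw [map_add]
    refine (congrArg₂ (· + ·) hX hY).trans ?_
    simp [eval, SkewMonoidAlgebra.sum_add_index', add_mul]

lemma eval_mul (X Y : S.𝓛) (a : Frac Λ) :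
    S.eval (X * Y) a = S.eval X (S.eval Y a) := by
  simp only [← evalHom_apply, map_mul]; rfl

lemma eval_add (X Y : S.𝓛) (a : Frac Λ) :
    S.eval (X + Y) a = S.eval X a + S.eval Y a := by
  simp only [← evalHom_apply, map_add]; rfl

/-- `X(γ) ∈ Γ` for all `γ ∈ Γ`. -/
def PreservesΓ (X : S.𝓛) : Prop :=
  ∀ γ ∈ S.Γ, ∃ γ' ∈ S.Γ,
    S.eval X (algebraMap Λ (Frac Λ) γ) = algebraMap Λ (Frac Λ) γ'

/-- A `Γ`-subring `U` of `𝒦` is a Galois `Γ`-ring in `𝒦` if `U K = 𝒦 = K U`. -/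
structure IsGaloisRing (U : Subring S.𝓛) : Prop where
  Γ_le : S.ΓSub ≤ U
  le_𝒦 : U ≤ S.𝒦
  mul_K : AddSubgroup.closure {z : S.𝓛 | ∃ u ∈ U, ∃ c ∈ S.KSub, z = u * c} = S.𝒦.toAddSubgroup
  K_mul : AddSubgroup.closure {z : S.𝓛 | ∃ c ∈ S.KSub, ∃ u ∈ U, z = c * u} = S.𝒦.toAddSubgroup

/-- For every finite-dimensional left `K`-subspace `W` of `𝒦`, the intersection `W ∩ U` is a
finitely generated left `Γ`-module. -/
def IsLeftGaloisOrder (U : Subring S.𝓛) : Prop :=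
  S.IsGaloisRing U ∧ ∀ W : Submodule S.KSub S.𝓛, (W : Set S.𝓛) ⊆ S.𝒦 → W.FG →
    ∃ N : Submodule S.ΓSub S.𝓛, (N : Set S.𝓛) = (W : Set S.𝓛) ∩ U ∧ N.FG

/-- For every finite-dimensional right `K`-subspace `W` of `𝒦`, the intersection `W ∩ U` is a
finitely generated right `Γ`-module. Right modules over a subring `R` of `𝓛` are modules over
`R.op`, which acts on `𝓛` by right multiplication. -/
def IsRightGaloisOrder (U : Subring S.𝓛) : Prop :=
  S.IsGaloisRing U ∧ ∀ W : Submodule S.KSub.op S.𝓛, (W : Set S.𝓛) ⊆ S.𝒦 → W.FG →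
    ∃ N : Submodule S.ΓSub.op S.𝓛, (N : Set S.𝓛) = (W : Set S.𝓛) ∩ U ∧ N.FG

/-- A Galois `Γ`-order in `𝒦`. -/
def IsGaloisOrder (U : Subring S.𝓛) : Prop :=
  S.IsLeftGaloisOrder U ∧ S.IsRightGaloisOrder U

/-- The subring generated by `Γ ∪ 𝒳`. -/
def generated (𝒳 : Set S.𝓛) : Subring S.𝓛 :=
  Subring.closure ((S.ΓSub : Set S.𝓛) ∪ 𝒳)

lemma Γ_le_generated (𝒳 : Set S.𝓛) : S.ΓSub ≤ S.generated 𝒳 :=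
  fun _ hx => Subring.subset_closure (Or.inl hx)

/-- `𝒦_Γ`, the ring of all `X ∈ 𝒦` with `X(γ) ∈ Γ` for all `γ ∈ Γ`. -/
def standard : Subring S.𝓛 where
  carrier := {X | X ∈ S.𝒦 ∧ S.PreservesΓ X}
  mul_mem' := by
    rintro X Y ⟨hX, hX'⟩ ⟨hY, hY'⟩
    refine ⟨mul_mem hX hY, fun γ hγ => ?_⟩
    obtain ⟨γ₁, h₁, e₁⟩ := hY' γ hγ
    obtain ⟨γ₂, h₂, e₂⟩ := hX' γ₁ h₁
    exact ⟨γ₂, h₂, by rw [S.eval_mul, e₁, e₂]⟩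
  one_mem' := ⟨one_mem _, fun γ hγ => ⟨γ, hγ, by simp [← evalHom_apply]⟩⟩
  add_mem' := by
    rintro X Y ⟨hX, hX'⟩ ⟨hY, hY'⟩
    refine ⟨add_mem hX hY, fun γ hγ => ?_⟩
    obtain ⟨γ₁, h₁, e₁⟩ := hX' γ hγ
    obtain ⟨γ₂, h₂, e₂⟩ := hY' γ hγ
    exact ⟨γ₁ + γ₂, add_mem h₁ h₂, by rw [S.eval_add, e₁, e₂, map_add]⟩
  zero_mem' := ⟨zero_mem _, fun γ hγ => ⟨0, zero_mem _, by simp [← evalHom_apply]⟩⟩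
  neg_mem' := by
    rintro X ⟨hX, hX'⟩
    refine ⟨neg_mem hX, fun γ hγ => ?_⟩
    obtain ⟨γ₁, h₁, e₁⟩ := hX' γ hγ
    exact ⟨-γ₁, neg_mem h₁, by
      rw [← evalHom_apply, map_neg, map_neg, ← e₁, ← evalHom_apply]; rfl⟩

lemma eval_gammaHom (γ : S.Γ) (a : Frac Λ) :
    S.eval (S.gammaHom γ) a = algebraMap Λ (Frac Λ) γ * a := by
  simp [eval, gammaHom, SkewMonoidAlgebra.singleOneRingHom]

lemma ΓSub_le_standard : S.ΓSub ≤ S.standard := by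
  rintro _ ⟨γ, rfl⟩
  refine ⟨fun g => ?_, fun γ' hγ' => ⟨γ * γ', mul_mem γ.2 hγ', ?_⟩⟩
  · change S.skewAut g (S.gammaHom γ) = S.gammaHom γ
    have h : g • algebraMap Λ (Frac Λ) γ = algebraMap Λ (Frac Λ) γ :=
      (smul_algebraMap_frac (g : RingAut Λ) (γ : Λ)).trans
        (congrArg (algebraMap Λ (Frac Λ)) (γ.2 g))
    simpa [gammaHom, SkewMonoidAlgebra.singleOneRingHom, h]
      using S.skewAut_single g 1 (algebraMap Λ (Frac Λ) γ)
  · rw [eval_gammaHom, map_mul]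

lemma generated_le_standard {𝒳 : Set S.𝓛} (h𝒦 : 𝒳 ⊆ S.𝒦) (hΓ : ∀ X ∈ 𝒳, S.PreservesΓ X) :
    S.generated 𝒳 ≤ S.standard :=
  Subring.closure_le.2 (Set.union_subset S.ΓSub_le_standard fun X hX => ⟨h𝒦 hX, hΓ X hX⟩)

/-- The additive endomorphism `γ ↦ X(γ)` of `Γ`, for `X ∈ 𝒦_Γ`. -/
def evalΓ (X : S.standard) (γ : S.Γ) : S.Γ :=
  ⟨(X.2.2 γ γ.2).choose, (X.2.2 γ γ.2).choose_spec.1⟩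

lemma algebraMap_evalΓ (X : S.standard) (γ : S.Γ) :
    algebraMap Λ (Frac Λ) (S.evalΓ X γ) =
      S.eval X (algebraMap Λ (Frac Λ) γ) :=
  (X.2.2 γ γ.2).choose_spec.2.symm

section Field

variable (k : Type v) [Field k] [Algebra k Λ]

/-- `G` and `M` act on `Λ` by `k`-algebra automorphisms. -/
class ActsLinearly : Prop where
  G_linear : ∀ g ∈ S.G, ∀ c : k, g (algebraMap k Λ c) = algebraMap k Λ c
  M_linear : ∀ μ ∈ S.M, ∀ c : k, μ (algebraMap k Λ c) = algebraMap k Λ c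

variable [S.ActsLinearly k]

/-- `Γ` is a `k`-subalgebra of `Λ`. -/
instance algebraΓ : Algebra k S.Γ :=
  ((algebraMap k Λ).codRestrict S.Γ
    (fun c (g : S.G) => ActsLinearly.G_linear (g : RingAut Λ) g.property c)).toAlgebra

lemma eval_algebraMap_mul (X : S.𝓛) (c : k) (a : Frac Λ) :
    S.eval X (algebraMap Λ (Frac Λ) (algebraMap k Λ c) * a) =
      algebraMap Λ (Frac Λ) (algebraMap k Λ c) * S.eval X a := by
  rw [eval, eval, SkewMonoidAlgebra.sum_def, SkewMonoidAlgebra.sum_def, Finsupp.sum, Finsupp.sum,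
    Finset.mul_sum]
  refine Finset.sum_congr rfl fun μ _ => ?_
  have h : μ • algebraMap Λ (Frac Λ) (algebraMap k Λ c) =
      algebraMap Λ (Frac Λ) (algebraMap k Λ c) :=
    (smul_algebraMap_frac (μ : RingAut Λ) _).trans
      (congrArg _ (ActsLinearly.M_linear (S := S) (μ : RingAut Λ) μ.2 c))
  rw [smul_mul', h]
  ring

/-- The `k`-linear endomorphism `γ ↦ X(γ)` of `Γ`, for `X ∈ 𝒦_Γ`. -/
def evalΓLinear (X : S.standard) : Module.End k S.Γ where
  toFun := S.evalΓ X
  map_add' γ γ' := by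
    apply Subtype.ext
    apply IsFractionRing.injective Λ (Frac Λ)
    simp only [algebraMap_evalΓ, Subring.coe_add, map_add, ← evalHom_apply]
  map_smul' c γ := by
    apply Subtype.ext
    apply IsFractionRing.injective Λ (Frac Λ)
    simp only [algebraMap_evalΓ, Algebra.smul_def, Subring.coe_mul, map_mul, RingHom.id_apply]
    exact S.eval_algebraMap_mul k X c _

lemma evalΓLinear_one :
    S.evalΓLinear k 1 = 1 := by
  ext γ
  apply IsFractionRing.injective Λ (Frac Λ)
  change algebraMap Λ (Frac Λ) (S.evalΓ _ γ) = _
  rw [algebraMap_evalΓ]; simp [← evalHom_apply]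

lemma evalΓLinear_zero :
    S.evalΓLinear k 0 = 0 := by
  ext γ
  apply IsFractionRing.injective Λ (Frac Λ)
  change algebraMap Λ (Frac Λ) (S.evalΓ _ γ) = _
  rw [algebraMap_evalΓ]; simp [← evalHom_apply]

lemma evalΓLinear_mul (X Y : S.standard) :
    S.evalΓLinear k (X * Y) = S.evalΓLinear k X * S.evalΓLinear k Y := by
  ext γ
  apply IsFractionRing.injective Λ (Frac Λ)
  change algebraMap Λ (Frac Λ) (S.evalΓ _ γ) = _
  change _ = algebraMap Λ (Frac Λ) (S.evalΓ X (S.evalΓ Y γ))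
  simp only [algebraMap_evalΓ, Subring.coe_mul, eval_mul]

lemma evalΓLinear_add (X Y : S.standard) :
    S.evalΓLinear k (X + Y) = S.evalΓLinear k X + S.evalΓLinear k Y := by
  ext γ
  apply IsFractionRing.injective Λ (Frac Λ)
  change algebraMap Λ (Frac Λ) (S.evalΓ _ γ) = _
  change _ = algebraMap Λ (Frac Λ) ((S.evalΓ X γ + S.evalΓ Y γ : S.Γ) : Λ)
  simp only [algebraMap_evalΓ, Subring.coe_add, map_add, eval_add]

/-- The dual space `Γ* = Hom_k(Γ, k)`, for use as a right module over a subring `U` of `𝒦_Γ`. -/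
def DualΓ (U : Subring S.𝓛) (_hU : U ≤ S.standard) : Type (max u v) := Module.Dual k S.Γ

variable {U : Subring S.𝓛} (hU : U ≤ S.standard)

instance : AddCommGroup (S.DualΓ k U hU) := inferInstanceAs (AddCommGroup (Module.Dual k S.Γ))

/-- The right action `τ X = τ ∘ X` of `U` on `Γ*`. -/
instance : Module Uᵐᵒᵖ (S.DualΓ k U hU) where
  smul X τ := LinearMap.comp (show Module.Dual k S.Γ from τ)
    (S.evalΓLinear k ⟨(unop X : U), hU (unop X).2⟩)
  one_smul _ := (congrArg (LinearMap.comp _) (S.evalΓLinear_one k)).trans (LinearMap.comp_id _)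
  mul_smul X Y _ := (congrArg (LinearMap.comp _)
    (S.evalΓLinear_mul k ⟨_, hU (unop Y).2⟩ ⟨_, hU (unop X).2⟩)).trans
      (LinearMap.comp_assoc _ _ _).symm
  smul_zero _ := LinearMap.zero_comp _
  smul_add _ _ _ := LinearMap.add_comp _ _ _
  add_smul X Y _ := (congrArg (LinearMap.comp _)
    (S.evalΓLinear_add k ⟨_, hU (unop X).2⟩ ⟨_, hU (unop Y).2⟩)).trans (LinearMap.comp_add _ _ _)
  zero_smul _ := (congrArg (LinearMap.comp _) (S.evalΓLinear_zero k)).trans (LinearMap.comp_zero _)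

/-- The right cyclic module `ξ U ⊆ Γ*`, for a character `ξ : Γ → k`. -/
def cyclicModule (ξ : S.Γ →ₐ[k] k) : Submodule Uᵐᵒᵖ (S.DualΓ k U hU) :=
  Submodule.span Uᵐᵒᵖ {(show S.DualΓ k U hU from ξ.toLinearMap)}

/-- The sum of all proper submodules of `ξ U`. -/
def properSum (ξ : S.Γ →ₐ[k] k) : Submodule Uᵐᵒᵖ (S.cyclicModule k hU ξ) :=
  sSup {N | N ≠ ⊤}

/-- The right `U`-module `V(ξ)`: the quotient of `ξ U` by the sum of its proper submodules. -/
abbrev V (ξ : S.Γ →ₐ[k] k) : Type (max u v) := S.cyclicModule k hU ξ ⧸ S.properSum k hU ξ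

section GelfandZeitlin

variable {U : Subring S.𝓛} (hΓ : S.ΓSub ≤ U)

/-- The inclusion `Γ → U`. -/
def toU : S.Γ →+* U := S.gammaHom.codRestrict U fun γ => hΓ ⟨γ, rfl⟩

/-- The ring homomorphism `k → Γ → Uᵒᵖ` through which right `U`-modules are `k`-vector spaces. -/
def scalarHom : k →+* Uᵐᵒᵖ :=
  ((S.toU hΓ).comp (algebraMap k S.Γ)).toOpposite fun a b => by
    rw [commute_iff_eq, ← map_mul, ← map_mul, mul_comm]

variable (V : Type w) [AddCommGroup V] [Module Uᵐᵒᵖ V]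

/-- A right `U`-module `V` is a Gelfand-Zeitlin module if `Γ` acts locally finitely on it:
`v Γ` spans a finite-dimensional `k`-vector space for every `v`. -/
def IsGelfandZeitlin : Prop :=
  letI : Module k V := Module.compHom V (S.scalarHom k hΓ)
  ∀ v : V, FiniteDimensional k
    (Submodule.span k (Set.range fun γ : S.Γ => (op (S.toU hΓ γ) : Uᵐᵒᵖ) • v))

variable {k}

/-- The generalized weight space `V_ξ = {v | v (ker ξ)^N = 0 for N ≫ 0}`. -/
def weightSpace (ξ : S.Γ →ₐ[k] k) : Set V :=
  {v | ∃ N₀ : ℕ, ∀ N ≥ N₀, ∀ γ ∈ RingHom.ker ξ ^ N, (op (S.toU hΓ γ) : Uᵐᵒᵖ) • v = 0}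

end GelfandZeitlin

end Field

end Datum

end GaloisOrder

end

noncomputable section

namespace GaloisOrder

/-! Everything rests on one independence statement. L/K is Galois with group G and K is the fraction
field of Γ, so separation and invariance make the restrictions to Γ of distinct elements of M
distinct (`M_ext`). By Dedekind they are linearly independent over L, so on a finite support s
finitely many values X(γ) recover each coefficient of X (`exists_dual`, `coeff_eq_sum_eval`).

Galois ring: the same independence shows that the supports in U form a monoid, hence all of M, and
that L U = L ∗ M. Averaging over G with an element of trace one descends this to K U = 𝒦
(`mem_closure_K_mul`). An Ore condition moves denominators to the right (`exists_mul_gammaHom_eq`).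

Order: the values X(γ) lie in Γ, so the coefficients of all X supported in s have a common
denominator (`exists_common_denominator`). Thus W ∩ U embeds in the noetherian Γ-module of functions
s → Λ. An element commuting with Γ is supported at 1, and its coefficient X(1) lies in Γ.

Modules: ΓXΓ is finitely generated as a left Γ-module, and composing with ξ turns left
Γ-coefficients into scalars, so ξXΓ is finite-dimensional. If every γ killing a vector v of ξU lies
in ker ξ, then vΓ contains a nonzero vector of weight ξ. Such a vector is a multiple of ξ, so v
generates ξU. Hence each vector of a proper submodule is killed by some γ with ξ(γ) ≠ 0. This
property survives sums and fails for ξ, so the sum of the proper submodules is proper. -/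

open Polynomial

/-! ### Preliminaries from linear and commutative algebra. -/

/-- Finitely many linearly independent functions are separated by a finite combination of point
evaluations. -/
lemma exists_dual_of_linearIndependent {ι X L : Type*} [DecidableEq ι] [Field L] {v : ι → X → L}
    (hv : LinearIndependent L v) (s : Finset ι) (i : ι) :
    ∃ c : X →₀ L, ∀ j ∈ s, (c.sum fun x a => a * v j x) = if j = i then 1 else 0 := by
  classical
  let w : X → s → L := fun x j => v j x
  -- A functional vanishing on all evaluation vectors `w x` is a linear relation among the `v j`.
  have hw : Submodule.span L (Set.range w) = ⊤ := by
    by_contra hne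
    obtain ⟨f, hf0, hf⟩ := Submodule.exists_le_ker_of_lt_top _ (lt_top_iff_ne_top.2 hne)
    have hsum : ∑ j : s, f (fun l => if j = l then 1 else 0) • v j = 0 := by
      funext x
      have h1 : f (w x) = 0 := hf (Submodule.subset_span ⟨x, rfl⟩)
      rw [LinearMap.pi_apply_eq_sum_univ] at h1
      rw [Finset.sum_apply]
      exact (Finset.sum_congr rfl fun j _ => mul_comm _ _).trans h1
    have hs : LinearIndependent L fun j : s => v j := hv.comp _ Subtype.val_injective
    have h0 := Fintype.linearIndependent_iff.1 hs _ hsum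
    refine hf0 (LinearMap.ext fun y => ?_)
    rw [LinearMap.pi_apply_eq_sum_univ]
    exact Finset.sum_eq_zero fun j _ => by rw [h0 j, smul_zero]
  obtain ⟨c, hc⟩ := Finsupp.mem_span_range_iff_exists_finsupp.1
    (hw ▸ Submodule.mem_top : (fun j : s => if (j : ι) = i then (1 : L) else 0) ∈
      Submodule.span L (Set.range w))
  refine ⟨c, fun j hj => ?_⟩
  have := congrFun hc ⟨j, hj⟩
  simpa [Finsupp.sum, Finset.sum_apply, w] using this

/-- A submodule which embeds, compatibly with scalars, into a noetherian module over another ring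
is finitely generated. -/
lemma fg_of_injOn_noetherian {R R' A B : Type*} [Ring R] [Ring R'] [AddCommGroup A] [Module R A]
    [AddCommGroup B] [Module R' B] (σ : R' → R) (ψ : A →+ B) (hψ : ∀ r x, ψ (σ r • x) = r • ψ x)
    (P : Submodule R' B) [IsNoetherian R' P] (N : Submodule R A) (hNP : ∀ x ∈ N, ψ x ∈ P)
    (hinj : ∀ x ∈ N, ψ x = 0 → x = 0) : N.FG := by
  classical
  let T : Submodule R' B :=
    { carrier := ψ '' N
      add_mem' := by
        rintro _ _ ⟨x, hx, rfl⟩ ⟨y, hy, rfl⟩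
        exact ⟨x + y, add_mem hx hy, map_add ψ x y⟩
      zero_mem' := ⟨0, zero_mem N, map_zero ψ⟩
      smul_mem' := by
        rintro r _ ⟨x, hx, rfl⟩
        exact ⟨σ r • x, N.smul_mem _ hx, hψ r x⟩ }
  have hT : T.FG := by
    have hle : T ≤ P := by rintro _ ⟨x, hx, rfl⟩; exact hNP x hx
    have := (isNoetherian_submodule.1 ‹IsNoetherian R' P›) T hle
    exact this
  obtain ⟨t, ht⟩ := hT
  have htN : (t : Set B) ⊆ ψ '' N := fun b hb =>
    (show b ∈ T from ht ▸ Submodule.subset_span hb)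
  obtain ⟨u, huN, rfl⟩ := Finset.subset_set_image_iff.1 htN
  refine ⟨u, le_antisymm (Submodule.span_le.2 huN) fun x hx => ?_⟩
  -- Linear combinations of the generators `ψ '' u` lift to the span of `u`; injectivity on `N` then
  -- identifies the lift of `ψ x` with `x`.
  have key : ∀ b ∈ Submodule.span R' ((u.image ψ : Finset B) : Set B),
      ∃ y ∈ Submodule.span R (u : Set A), ψ y = b := fun b hb => by
    induction hb using Submodule.span_induction with
    | mem b hb =>
      obtain ⟨y, hy, rfl⟩ := Finset.mem_image.1 hb
      exact ⟨y, Submodule.subset_span hy, rfl⟩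
    | zero => exact ⟨0, zero_mem _, map_zero ψ⟩
    | add b b' _ _ h h' =>
      obtain ⟨y, hy, rfl⟩ := h
      obtain ⟨y', hy', rfl⟩ := h'
      exact ⟨y + y', add_mem hy hy', map_add ψ y y'⟩
    | smul r b _ h =>
      obtain ⟨y, hy, rfl⟩ := h
      exact ⟨σ r • y, Submodule.smul_mem _ _ hy, hψ r y⟩
  obtain ⟨y, hy, hyx⟩ := key (ψ x) (ht ▸ ⟨x, hx, rfl⟩)
  have := hinj (x - y) (sub_mem hx (Submodule.span_le.2 huN hy)) (by rw [map_sub, hyx, sub_self])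
  rwa [sub_eq_zero.1 this]

/-- If `R / J` is finite-dimensional and `J` is contained in a prime `m`, then `R / J` contains a
nonzero element annihilated by `m`. -/
lemma exists_notMem_forall_mul_mem {k R : Type*} [Field k] [CommRing R] [Algebra k R]
    {J m : Ideal R} [m.IsPrime] [FiniteDimensional k (R ⧸ J)] (hJ : J ≤ m) :
    ∃ x, x ∉ J ∧ ∀ y ∈ m, y * x ∈ J := by
  have : IsArtinianRing (R ⧸ J) := IsArtinianRing.of_finite k _
  have hprime : (m.map (Ideal.Quotient.mk J)).IsPrime :=
    Ideal.map_isPrime_of_surjective Ideal.Quotient.mk_surjective (by rwa [Ideal.mk_ker])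
  -- Primes of an artinian ring are minimal, and primes minimal over the annihilator are associated.
  -- The element whose annihilator is `m / J` is the witness.
  have hmin : m.map (Ideal.Quotient.mk J) ∈
      (Module.annihilator (R ⧸ J) (R ⧸ J)).minimalPrimes :=
    IsArtinianRing.mem_minimalPrimes (by simp [Module.annihilator_eq_bot.2 inferInstance])
  have hass := Module.associatedPrimes.minimalPrimes_annihilator_subset_associatedPrimes (R ⧸ J) (R ⧸ J) hmin
  rw [AssociatedPrimes.mem_iff, isAssociatedPrime_iff] at hass
  obtain ⟨-, x, hx⟩ := hass
  obtain ⟨x, rfl⟩ := Ideal.Quotient.mk_surjective x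
  refine ⟨x, fun h => hprime.ne_top ?_, fun y hy => ?_⟩
  · rw [hx, Ideal.Quotient.eq_zero_iff_mem.2 h]
    simp
  · have h1 := Ideal.mem_map_of_mem (Ideal.Quotient.mk J) hy
    rw [hx, Submodule.mem_colon_singleton, Submodule.mem_bot, smul_eq_mul, ← map_mul] at h1
    exact Ideal.Quotient.eq_zero_iff_mem.1 h1

-- Galois theory of L over K and independence of the elements of M on Γ.

universe u v

variable {Λ : Type u} [CommRing Λ] [IsDomain Λ]

instance : FaithfulSMul (RingAut Λ) (Frac Λ) where
  eq_of_smul_eq_smul {σ τ} h := by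
    ext a
    apply IsFractionRing.injective Λ (Frac Λ)
    rw [← smul_algebraMap_frac, ← smul_algebraMap_frac, h]

namespace Datum

variable (S : Datum Λ)

instance : Finite S.G := S.finite_G

lemma smul_algebraMap_of_mem_Γ (g : S.G) {γ : Λ} (hγ : γ ∈ S.Γ) :
    g • algebraMap Λ (Frac Λ) γ = algebraMap Λ (Frac Λ) γ :=
  (smul_algebraMap_frac (g : RingAut Λ) γ).trans (congrArg _ (hγ g))

lemma smul_algebraMap_of_mem_M (μ : S.M) (a : Λ) :
    μ • algebraMap Λ (Frac Λ) a = algebraMap Λ (Frac Λ) ((μ : RingAut Λ) a) :=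
  smul_algebraMap_frac (μ : RingAut Λ) a

/-- `K` is the field of fractions of `Γ`. -/
lemma exists_div_of_mem_K {x : Frac Λ} (hx : x ∈ S.K) :
    ∃ γ ∈ S.Γ, ∃ δ ∈ S.Γ, δ ≠ 0 ∧ x = algebraMap Λ (Frac Λ) γ / algebraMap Λ (Frac Λ) δ := by
  classical
  have := Fintype.ofFinite S.G
  obtain ⟨a, b, hb, rfl⟩ := IsFractionRing.div_surjective (A := Λ) x
  have hb0 : b ≠ 0 := nonZeroDivisors.ne_zero hb
  have hinj := IsFractionRing.injective Λ (Frac Λ)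
  -- Enlarging the denominator to the norm of `b` makes it invariant; the new numerator is then
  -- invariant because the quotient is.
  have hδ : ∏ g : S.G, g • b ∈ S.Γ := fun h => by
    rw [Finset.smul_prod']
    exact Fintype.prod_equiv (Equiv.mulLeft h) _ _ fun g => by simp [mul_smul]
  have hδ0 : ∏ g : S.G, g • b ≠ 0 := Finset.prod_ne_zero_iff.2 fun g _ => by
    rwa [Ne, smul_eq_zero_iff_eq]
  have hib : algebraMap Λ (Frac Λ) b ≠ 0 := by
    rwa [Ne, map_eq_zero_iff _ hinj]
  have hiδ : algebraMap Λ (Frac Λ) (∏ g : S.G, g • b) ≠ 0 := by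
    rwa [Ne, map_eq_zero_iff _ hinj]
  have hsplit : ∏ g : S.G, g • b = b * ∏ g ∈ Finset.univ.erase (1 : S.G), g • b := by
    rw [← Finset.mul_prod_erase _ _ (Finset.mem_univ (1 : S.G)), one_smul]
  have heq : algebraMap Λ (Frac Λ) a / algebraMap Λ (Frac Λ) b =
      algebraMap Λ (Frac Λ) (a * ∏ g ∈ Finset.univ.erase (1 : S.G), g • b) /
        algebraMap Λ (Frac Λ) (∏ g : S.G, g • b) := by
    rw [div_eq_div_iff hib hiδ, ← map_mul, ← map_mul, hsplit]
    congr 1; ring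
  refine ⟨_, fun g => hinj ?_, _, hδ, hδ0, heq⟩
  have h1 : g • (algebraMap Λ (Frac Λ) a / algebraMap Λ (Frac Λ) b) =
      algebraMap Λ (Frac Λ) a / algebraMap Λ (Frac Λ) b := hx g
  have h2 := (smul_algebraMap_frac (g : RingAut Λ)
    (a * ∏ g ∈ Finset.univ.erase (1 : S.G), g • b)).symm
  refine h2.trans ?_
  rw [heq, div_eq_mul_inv, smul_mul', smul_inv'', S.smul_algebraMap_of_mem_Γ g hδ] at h1
  exact mul_right_cancel₀ (inv_ne_zero hiδ) h1

/-- Since K consists of fractions of Γ, `σ` is a K-automorphism of L, and by Artin's theorem these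
all come from G. -/
lemma mem_G_of_forall_Γ {σ : RingAut Λ} (h : ∀ γ ∈ S.Γ, σ γ = γ) : σ ∈ S.G := by
  have hK : ∀ x ∈ S.K, σ • x = x := fun x hx => by
    obtain ⟨γ, hγ, δ, hδ, -, rfl⟩ := S.exists_div_of_mem_K hx
    rw [div_eq_mul_inv, smul_mul', smul_inv'', smul_algebraMap_frac, smul_algebraMap_frac,
      h γ hγ, h δ hδ]
  let f : Frac Λ ≃ₐ[S.K] Frac Λ :=
    AlgEquiv.ofRingEquiv (f := MulSemiringAction.toRingEquiv (RingAut Λ) (Frac Λ) σ)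
      fun x => hK x x.2
  obtain ⟨g, hg⟩ := FixedPoints.toAlgAut_surjective S.G (Frac Λ) f
  have : (g : RingAut Λ) = σ :=
    FaithfulSMul.eq_of_smul_eq_smul fun x : Frac Λ => DFunLike.congr_fun hg x
  exact this ▸ g.2

/-- Elements of `M` are determined by their restriction to `Γ`. -/
lemma M_ext {μ ν : S.M} (h : ∀ γ ∈ S.Γ, (μ : RingAut Λ) γ = (ν : RingAut Λ) γ) : μ = ν := by
  have hg : (ν : RingAut Λ)⁻¹ * μ ∈ S.G := S.mem_G_of_forall_Γ fun γ hγ => by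
    rw [RingAut.mul_apply, h γ hγ, ← RingAut.mul_apply, inv_mul_cancel, RingAut.one_apply]
  -- Separation concerns M M⁻¹, whereas g = ν⁻¹μ has its inverse on the left. Invariance repairs
  -- this: gμg⁻¹ = ν⁻¹μν lies in M, and (ν⁻¹μν)ν⁻¹ = g.
  have h1 := S.separation _ (S.invariance _ hg μ μ.2) ν ν.2
    (by convert hg using 1; group)
  apply Subtype.ext
  have h2 : (ν : RingAut Λ)⁻¹ * μ = 1 := by rw [← h1]; group
  exact (inv_mul_eq_one.1 h2).symm

/-- The restriction of `μ ∈ M` to a multiplicative character `Γ → L`. -/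
def character (μ : S.M) : S.Γ →* Frac Λ :=
  (MulSemiringAction.toRingHom S.M (Frac Λ) μ : Frac Λ →* Frac Λ).comp
    (((algebraMap Λ (Frac Λ)).comp S.Γ.subtype : S.Γ →+* Frac Λ) : S.Γ →* Frac Λ)

lemma character_apply (μ : S.M) (γ : S.Γ) :
    S.character μ γ = μ • algebraMap Λ (Frac Λ) (γ : Λ) := rfl

lemma character_injective : Function.Injective S.character := fun μ ν h => by
  refine S.M_ext fun γ hγ => IsFractionRing.injective Λ (Frac Λ) ?_
  have := DFunLike.congr_fun h ⟨γ, hγ⟩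
  rwa [character_apply, character_apply, smul_algebraMap_of_mem_M,
    smul_algebraMap_of_mem_M] at this

lemma linearIndependent_character :
    LinearIndependent (Frac Λ) fun μ : S.M => (S.character μ : S.Γ → Frac Λ) :=
  (linearIndependent_monoidHom S.Γ (Frac Λ)).comp _ S.character_injective

open scoped Classical in
lemma exists_dual (s : Finset S.M) (μ : S.M) :
    ∃ c : S.Γ →₀ Frac Λ, ∀ ν ∈ s,
      (c.sum fun γ a => a * ν • algebraMap Λ (Frac Λ) (γ : Λ)) = if ν = μ then 1 else 0 :=
  exists_dual_of_linearIndependent S.linearIndependent_character s μ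

/-! ### Coefficients, their equivariance, and evaluation. -/

lemma coeff_coeffHom_mul (a : Frac Λ) (X : S.𝓛) (μ : S.M) :
    (S.coeffHom a * X).coeff μ = a * X.coeff μ :=
  SkewMonoidAlgebra.coeff_single_one_mul _ _ _

lemma coeff_mul_coeffHom (a : Frac Λ) (X : S.𝓛) (μ : S.M) :
    (X * S.coeffHom a).coeff μ = X.coeff μ * μ • a :=
  SkewMonoidAlgebra.coeff_mul_single_one _ _ _

lemma smul_eq_coeffHom_mul (a : Frac Λ) (X : S.𝓛) : a • X = S.coeffHom a * X := by
  ext μ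
  rw [coeff_coeffHom_mul]; rfl

lemma coeff_sum_apply {ι : Type*} (t : Finset ι) (f : ι → S.𝓛) (μ : S.M) :
    (∑ i ∈ t, f i).coeff μ = ∑ i ∈ t, (f i).coeff μ :=
  map_sum ((Finsupp.applyAddHom μ).comp
    (SkewMonoidAlgebra.coeffAddEquiv (k := Frac Λ) (G := S.M)).toAddMonoidHom) f t

lemma gammaHom_apply (γ : S.Γ) :
    S.gammaHom γ = S.coeffHom (algebraMap Λ (Frac Λ) (γ : Λ)) := rfl

omit [IsDomain Λ] in
lemma conj_injective (g : S.G) : Function.Injective (S.conj g) := fun μ ν h => by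
  have := congrArg (fun x : S.M => (x : RingAut Λ)) h
  apply Subtype.ext
  simpa [conj] using this

lemma coeff_skewAut (g : S.G) (X : S.𝓛) (μ : S.M) :
    (S.skewAut g X).coeff (S.conj g μ) = g • X.coeff μ := by
  classical
  induction X using SkewMonoidAlgebra.induction_on with
  | zero => simp
  | single ν x =>
    rw [skewAut_single, SkewMonoidAlgebra.coeff_single_apply, SkewMonoidAlgebra.coeff_single_apply]
    simp only [(S.conj_injective g).eq_iff]
    split_ifs <;> simp
  | add X Y hX hY => simp only [map_add, SkewMonoidAlgebra.coeff_add, Finsupp.add_apply, hX, hY,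
      smul_add]

lemma coeff_conj_of_mem_𝒦 {X : S.𝓛} (hX : X ∈ S.𝒦) (g : S.G) (μ : S.M) :
    X.coeff (S.conj g μ) = g • X.coeff μ := by
  conv_lhs => rw [← hX g]
  exact S.coeff_skewAut g X μ

omit [IsDomain Λ] in
lemma conj_inv_conj (g : S.G) (μ : S.M) : S.conj g (S.conj g⁻¹ μ) = μ := by
  apply Subtype.ext
  simp [conj, mul_assoc]

lemma conj_mem_support {X : S.𝓛} (hX : X ∈ S.𝒦) (g : S.G) {μ : S.M} :
    S.conj g μ ∈ X.support ↔ μ ∈ X.support := by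
  rw [SkewMonoidAlgebra.mem_support_iff, SkewMonoidAlgebra.mem_support_iff,
    S.coeff_conj_of_mem_𝒦 hX, Ne, Ne, smul_eq_zero_iff_eq]

lemma eval_eq_sum {X : S.𝓛} {s : Finset S.M} (hs : X.support ⊆ s) (a : Frac Λ) :
    S.eval X a = ∑ μ ∈ s, X.coeff μ * μ • a := by
  rw [eval, SkewMonoidAlgebra.sum_def]
  exact Finsupp.sum_of_support_subset _ hs _ fun μ _ => zero_mul _

open scoped Classical in
/-- A dual family recovers the coefficients of `X` from its values on `Γ`. -/
lemma coeff_eq_sum_eval {s : Finset S.M} {μ : S.M} (hμ : μ ∈ s) {c : S.Γ →₀ Frac Λ}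
    (hc : ∀ ν ∈ s, (c.sum fun γ a => a * ν • algebraMap Λ (Frac Λ) (γ : Λ)) =
      if ν = μ then 1 else 0) {X : S.𝓛} (hs : X.support ⊆ s) :
    X.coeff μ = c.sum fun γ a => a * S.eval X (algebraMap Λ (Frac Λ) (γ : Λ)) := by
  have h : ∀ γ : S.Γ, c γ * S.eval X (algebraMap Λ (Frac Λ) (γ : Λ)) =
      ∑ ν ∈ s, X.coeff ν * (c γ * ν • algebraMap Λ (Frac Λ) (γ : Λ)) := fun γ => by
    rw [S.eval_eq_sum hs, Finset.mul_sum]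
    exact Finset.sum_congr rfl fun ν _ => by ring
  rw [Finsupp.sum, Finset.sum_congr rfl fun γ _ => h γ, Finset.sum_comm]
  have h2 : ∀ ν ∈ s, ∑ γ ∈ c.support, X.coeff ν * (c γ * ν • algebraMap Λ (Frac Λ) (γ : Λ)) =
      if ν = μ then X.coeff μ else 0 := fun ν hν => by
    rw [← Finset.mul_sum]
    refine (congrArg _ (hc ν hν)).trans ?_
    split_ifs with h
    · rw [h, mul_one]
    · rw [mul_zero]
  rw [Finset.sum_congr rfl h2, Finset.sum_ite_eq' s μ, if_pos hμ]

/-! ### The Ore condition. -/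

/-- Right Ore condition: for `X ∈ 𝒦` the product `Q = ∏ (T - ν⁻¹ δ)` over `ν ∈ Supp X` has
coefficients in `Γ` and satisfies `∑ δ^i X q_i = 0`. -/
lemma exists_mul_gammaHom_eq {U : Subring S.𝓛} (hΓU : S.ΓSub ≤ U) {X : S.𝓛} (hXU : X ∈ U)
    (hX : X ∈ S.𝒦) {δ : S.Γ} (hδ : δ ≠ 0) :
    ∃ q : S.Γ, q ≠ 0 ∧ ∃ Z ∈ U, X * S.gammaHom q = S.gammaHom δ * Z := by
  classical
  let Q : Λ[X] := ∏ ν ∈ X.support, (Polynomial.X - C (((ν : RingAut Λ)⁻¹ : RingAut Λ) (δ : Λ)))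
  -- Conjugation by `g` permutes Supp X, and g(ν⁻¹δ) = (gνg⁻¹)⁻¹δ because δ is invariant; so `g`
  -- permutes the factors of `Q`.
  have hQ : ∀ i, Q.coeff i ∈ S.Γ := fun i g => by
    have h1 : Q.map ((g : RingAut Λ) : Λ →+* Λ) = Q := by
      simp only [Q, Polynomial.map_prod, Polynomial.map_sub, Polynomial.map_X, Polynomial.map_C]
      refine Finset.prod_nbij' (S.conj g) (S.conj g⁻¹)
        (fun ν hν => (S.conj_mem_support hX g).2 hν)
        (fun ν hν => (S.conj_mem_support hX g⁻¹).2 hν)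
        (fun ν _ => by simpa using S.conj_inv_conj g⁻¹ ν)
        (fun ν _ => S.conj_inv_conj g ν) fun ν _ => ?_
      have hd : (g : RingAut Λ)⁻¹ (δ : Λ) = δ := δ.2 g⁻¹
      congr 2
      change (g : RingAut Λ) (((ν : RingAut Λ)⁻¹ : RingAut Λ) (δ : Λ)) =
        ((g : RingAut Λ) * ν * (g : RingAut Λ)⁻¹)⁻¹ (δ : Λ)
      simp only [mul_inv_rev, inv_inv, RingAut.mul_apply, hd]
    change (g : RingAut Λ) (Q.coeff i) = Q.coeff i
    conv_rhs => rw [← h1, Polynomial.coeff_map]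
    rfl
  let q : ℕ → S.Γ := fun i => ⟨Q.coeff i, hQ i⟩
  have hδ' : (δ : Λ) ≠ 0 := fun h => hδ (Subtype.ext h)
  -- The μ-coefficient is x_μ times the value at δ of μ(Q), which has the factor T − μμ⁻¹δ = T − δ.
  have hzero : ∑ i ∈ Finset.range (Q.natDegree + 1),
      S.gammaHom δ ^ i * X * S.gammaHom (q i) = 0 := by
    ext μ
    rw [coeff_sum_apply]
    have hterm : ∀ i, (S.gammaHom δ ^ i * X * S.gammaHom (q i)).coeff μ =
        X.coeff μ * algebraMap Λ (Frac Λ) ((μ : RingAut Λ) (Q.coeff i) * (δ : Λ) ^ i) := fun i => by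
      rw [← map_pow, gammaHom_apply, gammaHom_apply, coeff_mul_coeffHom, coeff_coeffHom_mul,
        smul_algebraMap_of_mem_M, map_mul]
      simp only [Subring.coe_pow, q]
      ring
    rw [Finset.sum_congr rfl fun i _ => hterm i, ← Finset.mul_sum, ← map_sum]
    by_cases hμ : μ ∈ X.support
    · have h2 : ∑ i ∈ Finset.range (Q.natDegree + 1), (μ : RingAut Λ) (Q.coeff i) * (δ : Λ) ^ i =
          Q.eval₂ ((μ : RingAut Λ) : Λ →+* Λ) δ :=
        (Polynomial.eval₂_eq_sum_range ((μ : RingAut Λ) : Λ →+* Λ) (δ : Λ)).symm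
      have h3 : Q.eval₂ ((μ : RingAut Λ) : Λ →+* Λ) δ = 0 := by
        rw [Polynomial.eval₂_finsetProd]
        refine Finset.prod_eq_zero hμ ?_
        simp only [Polynomial.eval₂_sub, Polynomial.eval₂_X, Polynomial.eval₂_C]
        change (δ : Λ) - ((μ : RingAut Λ) * (μ : RingAut Λ)⁻¹) (δ : Λ) = 0
        rw [mul_inv_cancel, RingAut.one_apply, sub_self]
      rw [h2, h3, map_zero, mul_zero]; rfl
    · rw [SkewMonoidAlgebra.notMem_support_iff.1 hμ, zero_mul]; rfl
  -- The term i = 0 is X q₀, with q₀ = ±∏ ν⁻¹δ ≠ 0; all other terms have a factor δ on the left.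
  refine ⟨q 0, fun h => ?_, -∑ i ∈ Finset.range Q.natDegree,
    S.gammaHom δ ^ i * X * S.gammaHom (q (i + 1)), neg_mem (sum_mem fun i _ =>
      mul_mem (mul_mem (pow_mem (hΓU ⟨δ, rfl⟩) i) hXU) (hΓU ⟨_, rfl⟩)), ?_⟩
  · have h4 : Q.coeff 0 = 0 := congrArg Subtype.val h
    rw [Polynomial.coeff_zero_eq_eval_zero, Polynomial.eval_prod] at h4
    obtain ⟨ν, -, hν⟩ := Finset.prod_eq_zero_iff.1 h4
    exact hδ' (by simpa using hν)
  · rw [Finset.sum_range_succ', pow_zero, one_mul] at hzero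
    rw [eq_neg_of_add_eq_zero_right hzero, mul_neg, Finset.mul_sum]
    congr 1
    exact Finset.sum_congr rfl fun i _ => by rw [pow_succ']; simp only [mul_assoc]

/-! ### Galois descent and the equalities U K = 𝒦 = K U. -/

lemma coeffHom_mem_𝒦 {c : Frac Λ} (hc : c ∈ S.K) : S.coeffHom c ∈ S.𝒦 := fun g => by
  change S.skewAut g (SkewMonoidAlgebra.single 1 c) = SkewMonoidAlgebra.single 1 c
  rw [skewAut_single, map_one, show g • c = c from hc g]

lemma KSub_le_𝒦 : S.KSub ≤ S.𝒦 := by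
  rintro _ ⟨c, hc, rfl⟩
  exact S.coeffHom_mem_𝒦 hc

/-- The elements of G are independent as characters of L, so some trace is nonzero; it is invariant
and can be divided out. -/
lemma exists_trace_eq_one [Fintype S.G] : ∃ c : Frac Λ, ∑ g : S.G, g • c = 1 := by
  have hli := linearIndependent_monoidHom (Frac Λ) (Frac Λ)
  let e : S.G → (Frac Λ →* Frac Λ) := fun g => (MulSemiringAction.toRingHom S.G (Frac Λ) g : _ →* _)
  have he : Function.Injective e := fun g h hgh =>
    FaithfulSMul.eq_of_smul_eq_smul fun x : Frac Λ => DFunLike.congr_fun hgh x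
  obtain ⟨a, ha⟩ : ∃ a : Frac Λ, ∑ g : S.G, g • a ≠ 0 := by
    by_contra! h
    refine one_ne_zero (Fintype.linearIndependent_iff.1 (hli.comp e he) (fun _ => 1) ?_ 1)
    funext a
    simpa [Finset.sum_apply, e] using h a
  have hinv : ∀ g : S.G, g • (∑ h : S.G, h • a) = ∑ h : S.G, h • a := fun g => by
    rw [Finset.smul_sum]
    exact Fintype.sum_equiv (Equiv.mulLeft g) _ _ fun h => by simp [mul_smul]
  refine ⟨a * (∑ h : S.G, h • a)⁻¹, ?_⟩
  simp_rw [smul_mul', smul_inv'', hinv]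
  rw [← Finset.sum_mul, mul_inv_cancel₀ ha]

lemma coeffHom_trace_mem_KSub [Fintype S.G] (a : Frac Λ) :
    S.coeffHom (∑ g : S.G, g • a) ∈ S.KSub := by
  refine ⟨_, fun g => ?_, rfl⟩
  rw [Finset.smul_sum]
  exact Fintype.sum_equiv (Equiv.mulLeft g) _ _ fun h => by simp [mul_smul]

lemma skewAut_coeffHom_mul (g : S.G) (a : Frac Λ) (X : S.𝓛) :
    S.skewAut g (S.coeffHom a * X) = S.coeffHom (g • a) * S.skewAut g X := by
  rw [map_mul]
  congr 1
  exact (S.skewAut_single g 1 a).trans (by rw [map_one]; rfl)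

/-- Galois descent: if `U ⊆ 𝒦` spans `L ∗ M` over `L`, then `K U = 𝒦`. -/
lemma mem_closure_K_mul {U : Subring S.𝓛} (hU : U ≤ S.𝒦)
    (hspan : Submodule.span (Frac Λ) (U : Set S.𝓛) = ⊤) {Y : S.𝓛} (hY : Y ∈ S.𝒦) :
    Y ∈ AddSubgroup.closure {z : S.𝓛 | ∃ c ∈ S.KSub, ∃ u ∈ U, z = c * u} := by
  have := Fintype.ofFinite S.G
  obtain ⟨c, hc⟩ := S.exists_trace_eq_one
  -- For invariant u, the trace of a u is tr(a) u with tr(a) ∈ K. Quantifying over all `a` lets the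
  -- induction absorb scalars from L.
  have key : ∀ (Z : S.𝓛), Z ∈ Submodule.span (Frac Λ) (U : Set S.𝓛) → ∀ a : Frac Λ,
      ∑ g : S.G, S.skewAut g (S.coeffHom a * Z) ∈
        AddSubgroup.closure {z : S.𝓛 | ∃ c ∈ S.KSub, ∃ u ∈ U, z = c * u} := fun Z hZ => by
    induction hZ using Submodule.span_induction with
    | mem u hu =>
      intro a
      refine AddSubgroup.subset_closure ⟨_, S.coeffHom_trace_mem_KSub a, u, hu, ?_⟩
      rw [map_sum, Finset.sum_mul]
      exact Finset.sum_congr rfl fun g _ => by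
        rw [skewAut_coeffHom_mul, show S.skewAut g u = u from hU hu g]
    | zero => intro a; simp
    | add Z Z' _ _ h h' =>
      intro a
      simp only [mul_add, map_add, Finset.sum_add_distrib]
      exact add_mem (h a) (h' a)
    | smul b Z _ h =>
      intro a
      rw [smul_eq_coeffHom_mul, ← mul_assoc, ← map_mul]
      exact h _
  have h1 := key Y (hspan ▸ Submodule.mem_top) c
  have h2 : ∑ g : S.G, S.skewAut g (S.coeffHom c * Y) = Y := by
    simp_rw [skewAut_coeffHom_mul, show ∀ g : S.G, S.skewAut g Y = Y from hY]
    rw [← Finset.sum_mul, ← map_sum, hc, map_one, one_mul]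
  rwa [h2] at h1

/-- If `X ∈ U` then `L U` contains every `μ ∈ Supp X`. -/
lemma single_mem_span {U : Subring S.𝓛} (hΓU : S.ΓSub ≤ U) {X : S.𝓛} (hX : X ∈ U) {μ : S.M}
    (hμ : μ ∈ X.support) (a : Frac Λ) :
    SkewMonoidAlgebra.single μ a ∈ Submodule.span (Frac Λ) (U : Set S.𝓛) := by
  classical
  obtain ⟨c, hc⟩ := S.exists_dual X.support μ
  -- Right multiplication by γ multiplies x_ν by ν(γ), so the dual family isolates the μ-component.
  have h : c.sum (fun γ b => b • (X * S.gammaHom γ)) = SkewMonoidAlgebra.single μ (X.coeff μ) := by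
    ext ν
    rw [Finsupp.sum, coeff_sum_apply, SkewMonoidAlgebra.coeff_single_apply]
    have h1 : ∀ γ, (c γ • (X * S.gammaHom γ)).coeff ν =
        X.coeff ν * (c γ * ν • algebraMap Λ (Frac Λ) (γ : Λ)) := fun γ => by
      rw [smul_eq_coeffHom_mul, coeff_coeffHom_mul, gammaHom_apply, coeff_mul_coeffHom]
      ring
    rw [Finset.sum_congr rfl fun γ _ => h1 γ, ← Finset.mul_sum]
    by_cases hν : ν ∈ X.support
    · refine (congrArg _ (hc ν hν)).trans ?_
      by_cases h : ν = μ
      · rw [if_pos h, if_pos h.symm, h, mul_one]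
      · rw [if_neg h, if_neg (Ne.symm h), mul_zero]
    · rw [SkewMonoidAlgebra.notMem_support_iff.1 hν, zero_mul,
        if_neg fun h : μ = ν => hν (h ▸ hμ)]
  have hmem : SkewMonoidAlgebra.single μ (X.coeff μ) ∈
      Submodule.span (Frac Λ) (U : Set S.𝓛) := h ▸ Submodule.sum_mem _ fun γ _ =>
    Submodule.smul_mem _ _ (Submodule.subset_span (mul_mem hX (hΓU ⟨γ, rfl⟩)))
  have h2 := Submodule.smul_mem _ (a * (X.coeff μ)⁻¹) hmem
  rwa [SkewMonoidAlgebra.smul_single, smul_eq_mul,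
    inv_mul_cancel_right₀ (SkewMonoidAlgebra.mem_support_iff.1 hμ)] at h2

/-- As a function of γ this coefficient is a combination of the characters ν ∈ Supp X, so
independence can be applied to it. -/
lemma coeff_mul_mul_gammaHom_mul (X Y : S.𝓛) (γ : S.Γ) (μ : S.M) :
    (X * S.gammaHom γ * Y).coeff μ = ∑ ν ∈ X.support,
      X.coeff ν * ν • algebraMap Λ (Frac Λ) (γ : Λ) *
        (SkewMonoidAlgebra.single ν 1 * Y).coeff μ := by
  have h : X * S.gammaHom γ = ∑ ν ∈ X.support, SkewMonoidAlgebra.single ν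
      (X.coeff ν * ν • algebraMap Λ (Frac Λ) (γ : Λ)) := by
    classical
    ext ν
    rw [gammaHom_apply, coeff_mul_coeffHom, coeff_sum_apply]
    simp_rw [SkewMonoidAlgebra.coeff_single_apply]
    rw [Finset.sum_ite_eq' X.support ν]
    split_ifs with hν
    · rfl
    · rw [SkewMonoidAlgebra.notMem_support_iff.1 hν, zero_mul]
  rw [h, Finset.sum_mul, coeff_sum_apply]
  refine Finset.sum_congr rfl fun ν _ => ?_
  rw [← coeff_coeffHom_mul, ← mul_assoc]
  congr 3
  rw [coeffHom, SkewMonoidAlgebra.singleOneRingHom]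
  simp [SkewMonoidAlgebra.single_mul_single]

/-- The union of the supports of the elements of a `Γ`-subring is a submonoid of `M`. -/
def supportMonoid {U : Subring S.𝓛} (hΓU : S.ΓSub ≤ U) : Submonoid S.M where
  carrier := {μ | ∃ X ∈ U, μ ∈ X.support}
  one_mem' := ⟨1, one_mem U, by
    rw [SkewMonoidAlgebra.mem_support_iff, SkewMonoidAlgebra.coeff_one, Finsupp.single_eq_same]
    exact one_ne_zero⟩
  mul_mem' := by
    classical
    rintro μ ν ⟨X, hX, hμ⟩ ⟨Y, hY, hν⟩
    by_contra h
    -- In X Y itself the term at μν may cancel. If it vanishes in XγY for every γ, independence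
    -- kills the contribution of μ alone, which is x_μ μ(y_ν) ≠ 0.
    have h0 : ∀ γ : S.Γ, (X * S.gammaHom γ * Y).coeff (μ * ν) = 0 := fun γ => by
      by_contra hne
      exact h ⟨_, mul_mem (mul_mem hX (hΓU ⟨γ, rfl⟩)) hY, SkewMonoidAlgebra.mem_support_iff.2 hne⟩
    have hsum : ∑ κ ∈ X.support, (X.coeff κ * (SkewMonoidAlgebra.single κ 1 * Y).coeff (μ * ν)) •
        (S.character κ : S.Γ → Frac Λ) = 0 := by
      funext γ
      rw [Finset.sum_apply]
      refine (Finset.sum_congr rfl fun κ _ => ?_).trans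
        ((S.coeff_mul_mul_gammaHom_mul X Y γ (μ * ν)).symm.trans (h0 γ))
      rw [Pi.smul_apply, character_apply, smul_eq_mul]
      ring
    have h1 := linearIndependent_iff'.1 S.linearIndependent_character _ _ hsum μ hμ
    rw [SkewMonoidAlgebra.coeff_single_mul_aux Y (z := ν) fun κ => by
        rw [Subtype.ext_iff, Subtype.ext_iff]; exact mul_right_inj (μ : RingAut Λ)] at h1
    simp only [one_mul, mul_eq_zero] at h1
    rcases h1 with h1 | h1
    · exact SkewMonoidAlgebra.mem_support_iff.1 hμ h1
    · have h2 : (μ : RingAut Λ) • Y.coeff ν = 0 := h1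
      rw [smul_eq_zero_iff_eq] at h2
      exact SkewMonoidAlgebra.mem_support_iff.1 hν h2

lemma span_eq_top {U : Subring S.𝓛} (hΓU : S.ΓSub ≤ U) (hM : S.supportMonoid hΓU = ⊤) :
    Submodule.span (Frac Λ) (U : Set S.𝓛) = ⊤ := by
  refine Submodule.eq_top_iff'.2 fun X => ?_
  induction X using SkewMonoidAlgebra.induction_on with
  | zero => exact zero_mem _
  | single μ a =>
    obtain ⟨X, hX, hμ⟩ := (hM ▸ Submonoid.mem_top μ : μ ∈ S.supportMonoid hΓU)
    exact S.single_mem_span hΓU hX hμ a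
  | add X Y hX hY => exact add_mem hX hY

lemma exists_eq_inv_mul_of_mem_KSub {c : S.𝓛} (hc : c ∈ S.KSub) :
    ∃ γ δ : S.Γ, δ ≠ 0 ∧
      c = S.coeffHom (algebraMap Λ (Frac Λ) (δ : Λ))⁻¹ * S.gammaHom γ := by
  obtain ⟨_, hx, rfl⟩ := hc
  obtain ⟨γ, hγ, δ, hδ, hδ0, rfl⟩ := S.exists_div_of_mem_K hx
  refine ⟨⟨γ, hγ⟩, ⟨δ, hδ⟩, fun h => hδ0 (congrArg Subtype.val h), ?_⟩
  rw [gammaHom_apply, ← map_mul, div_eq_inv_mul]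

lemma algebraMap_Γ_ne_zero {δ : S.Γ} (hδ : δ ≠ 0) : algebraMap Λ (Frac Λ) (δ : Λ) ≠ 0 := by
  rw [Ne, map_eq_zero_iff _ (IsFractionRing.injective Λ (Frac Λ))]
  exact fun h => hδ (Subtype.ext h)

lemma inv_algebraMap_mem_K (δ : S.Γ) : (algebraMap Λ (Frac Λ) (δ : Λ))⁻¹ ∈ S.K :=
  inv_mem fun g => S.smul_algebraMap_of_mem_Γ g δ.2

lemma isGaloisRing {U : Subring S.𝓛} (hΓU : S.ΓSub ≤ U) (hU : U ≤ S.𝒦)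
    (hM : S.supportMonoid hΓU = ⊤) : S.IsGaloisRing U := by
  have hK : AddSubgroup.closure {z : S.𝓛 | ∃ c ∈ S.KSub, ∃ u ∈ U, z = c * u} =
      S.𝒦.toAddSubgroup := by
    refine le_antisymm ((AddSubgroup.closure_le _).2 ?_) fun Y hY =>
      S.mem_closure_K_mul hU (S.span_eq_top hΓU hM) hY
    rintro _ ⟨c, hc, u, hu, rfl⟩
    exact S.𝒦.mul_mem (S.KSub_le_𝒦 hc) (hU hu)
  refine ⟨hΓU, hU, le_antisymm ((AddSubgroup.closure_le _).2 ?_) ?_, hK⟩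
  · rintro _ ⟨u, hu, c, hc, rfl⟩
    exact S.𝒦.mul_mem (hU hu) (S.KSub_le_𝒦 hc)
  · rw [← hK]
    refine (AddSubgroup.closure_le _).2 ?_
    rintro _ ⟨c, hc, u, hu, rfl⟩
    obtain ⟨γ, δ, hδ, rfl⟩ := S.exists_eq_inv_mul_of_mem_KSub hc
    have hγu : S.gammaHom γ * u ∈ U := mul_mem (hΓU ⟨γ, rfl⟩) hu
    -- From γuq = δZ follows δ⁻¹γu = Zq⁻¹, which moves the denominator to the right.
    obtain ⟨q, hq, Z, hZ, hqZ⟩ := S.exists_mul_gammaHom_eq hΓU hγu (hU hγu) hδ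
    refine AddSubgroup.subset_closure ⟨Z, hZ, S.coeffHom (algebraMap Λ (Frac Λ) (q : Λ))⁻¹,
      ⟨_, S.inv_algebraMap_mem_K q, rfl⟩, ?_⟩
    have h1 : S.gammaHom q * S.coeffHom (algebraMap Λ (Frac Λ) (q : Λ))⁻¹ = 1 := by
      rw [gammaHom_apply, ← map_mul, mul_inv_cancel₀ (S.algebraMap_Γ_ne_zero hq), map_one]
    have h2 : S.coeffHom (algebraMap Λ (Frac Λ) (δ : Λ))⁻¹ * S.gammaHom δ = 1 := by
      rw [gammaHom_apply, ← map_mul, inv_mul_cancel₀ (S.algebraMap_Γ_ne_zero hδ), map_one]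
    calc _ = S.coeffHom (algebraMap Λ (Frac Λ) (δ : Λ))⁻¹ * (S.gammaHom γ * u * S.gammaHom q) *
          S.coeffHom (algebraMap Λ (Frac Λ) (q : Λ))⁻¹ := by
            simp only [mul_assoc, h1, mul_one]
      _ = _ := by rw [hqZ, ← mul_assoc, h2, one_mul]

lemma supportMonoid_generated {𝒳 : Set S.𝓛}
    (hsupp : Submonoid.closure (⋃ X ∈ 𝒳, (X.support : Set S.M)) = ⊤) :
    S.supportMonoid (S.Γ_le_generated 𝒳) = ⊤ := by
  refine top_unique (hsupp ▸ Submonoid.closure_le.2 (Set.iUnion₂_subset fun X hX μ hμ => ?_))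
  exact ⟨X, Subring.subset_closure (Or.inr hX), hμ⟩

/-! ### Common denominators and finite generation. -/

/-- The coefficients of the elements of `𝒦_Γ` with support in a fixed finite set have a common
denominator. -/
lemma exists_common_denominator (s : Finset S.M) : ∃ d : Λ, d ≠ 0 ∧ ∀ X ∈ S.standard,
    X.support ⊆ s → ∀ μ ∈ s, ∃ b : Λ,
      algebraMap Λ (Frac Λ) d * X.coeff μ = algebraMap Λ (Frac Λ) b := by
  classical
  have h1 : ∀ μ ∈ s, ∃ d : Λ, d ≠ 0 ∧ ∀ X ∈ S.standard, X.support ⊆ s → ∃ b : Λ,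
      algebraMap Λ (Frac Λ) d * X.coeff μ = algebraMap Λ (Frac Λ) b := fun μ hμ => by
    obtain ⟨c, hc⟩ := S.exists_dual s μ
    -- It suffices to clear the denominators of the dual family, which does not depend on X, since
    -- the values X(γ) are already in Γ.
    obtain ⟨d, hd⟩ := IsLocalization.exist_integer_multiples (nonZeroDivisors Λ) c.support c
    refine ⟨d, nonZeroDivisors.ne_zero d.2, fun X hX hs => ?_⟩
    rw [S.coeff_eq_sum_eval hμ hc hs, Finsupp.sum, Finset.mul_sum]
    refine (?_ : _ ∈ (algebraMap Λ (Frac Λ)).range).imp fun b hb => hb.symm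
    refine sum_mem fun γ hγ => ?_
    obtain ⟨γ', -, hγ'⟩ := hX.2 γ γ.2
    obtain ⟨b, hb⟩ := hd γ hγ
    rw [hγ', ← mul_assoc, ← Algebra.smul_def, ← hb, ← map_mul]
    exact ⟨_, rfl⟩
  choose! d hd using h1
  refine ⟨∏ μ ∈ s, d μ, Finset.prod_ne_zero_iff.2 fun μ hμ => (hd μ hμ).1,
    fun X hX hs μ hμ => ?_⟩
  obtain ⟨b, hb⟩ := (hd μ hμ).2 X hX hs
  refine ⟨b * ∏ ν ∈ s.erase μ, d ν, ?_⟩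
  rw [← Finset.mul_prod_erase _ _ hμ, map_mul, map_mul, ← hb]
  ring

instance : IsNoetherian S.Γ Λ := S.noetherian

/-- The functions `s → L` with values in `Λ`. -/
def integralFunctions (s : Finset S.M) : Submodule S.Γ (s → Frac Λ) :=
  LinearMap.range (((Algebra.linearMap Λ (Frac Λ)).restrictScalars S.Γ).compLeft s)

instance (s : Finset S.M) : IsNoetherian S.Γ (S.integralFunctions s) :=
  inferInstanceAs (IsNoetherian S.Γ (LinearMap.range _))

lemma eq_zero_of_forall_coeff {s : Finset S.M} {X : S.𝓛} (hs : X.support ⊆ s)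
    (h : ∀ μ ∈ s, X.coeff μ = 0) : X = 0 := by
  ext μ
  by_cases hμ : μ ∈ X.support
  · exact h μ (hs hμ)
  · exact SkewMonoidAlgebra.notMem_support_iff.1 hμ

/-- The map `X ↦ (d x_μ)_{μ ∈ s}`. -/
def scaledCoeff (d : Frac Λ) (s : Finset S.M) : S.𝓛 →+ (s → Frac Λ) where
  toFun X μ := d * X.coeff μ
  map_zero' := by funext μ; simp
  map_add' X Y := by funext μ; simp [mul_add]

lemma fg_left {N : Submodule S.ΓSub S.𝓛} (hN : ∀ X ∈ N, X ∈ S.standard) {s : Finset S.M}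
    (hs : ∀ X ∈ N, X.support ⊆ s) : N.FG := by
  obtain ⟨d, hd, hds⟩ := S.exists_common_denominator s
  have hd' : algebraMap Λ (Frac Λ) d ≠ 0 := by
    rwa [Ne, map_eq_zero_iff _ (IsFractionRing.injective Λ (Frac Λ))]
  refine fg_of_injOn_noetherian (R' := S.Γ) (fun γ => (⟨S.gammaHom γ, γ, rfl⟩ : S.ΓSub))
    (S.scaledCoeff (algebraMap Λ (Frac Λ) d) s) (fun γ X => ?_) (S.integralFunctions s) N
    (fun X hX => ?_) fun X hX h => S.eq_zero_of_forall_coeff (hs X hX) fun μ hμ => ?_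
  · funext μ
    change algebraMap Λ (Frac Λ) d * (S.gammaHom γ * X).coeff μ =
      (γ : Λ) • (algebraMap Λ (Frac Λ) d * X.coeff μ)
    rw [gammaHom_apply, coeff_coeffHom_mul, Algebra.smul_def]
    ring
  · choose b hb using fun μ : s => hds X (hN X hX) (hs X hX) μ μ.2
    exact ⟨b, funext fun μ => (hb μ).symm⟩
  · exact (mul_eq_zero.1 (congrFun h ⟨μ, hμ⟩)).resolve_left hd'

/-- The map `X ↦ (μ⁻¹(d x_μ))_{μ ∈ s}`. -/
def twistedCoeff (d : Frac Λ) (s : Finset S.M) : S.𝓛 →+ (s → Frac Λ) where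
  toFun X μ := ((μ : S.M) : RingAut Λ)⁻¹ • (d * X.coeff μ)
  map_zero' := by funext μ; simp
  map_add' X Y := by funext μ; simp [mul_add]

/-- Right multiplication by γ acts on x_μ as μ(γ). Applying μ⁻¹, which preserves Λ, turns this into
ordinary multiplication by γ, so the embedding argument of `fg_left` applies. -/
lemma fg_right {N : Submodule S.ΓSub.op S.𝓛} (hN : ∀ X ∈ N, X ∈ S.standard) {s : Finset S.M}
    (hs : ∀ X ∈ N, X.support ⊆ s) : N.FG := by
  obtain ⟨d, hd, hds⟩ := S.exists_common_denominator s
  have hd' : algebraMap Λ (Frac Λ) d ≠ 0 := by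
    rwa [Ne, map_eq_zero_iff _ (IsFractionRing.injective Λ (Frac Λ))]
  refine fg_of_injOn_noetherian (R' := S.Γ)
    (fun γ => (⟨op (S.gammaHom γ), γ, rfl⟩ : S.ΓSub.op))
    (S.twistedCoeff (algebraMap Λ (Frac Λ) d) s) (fun γ X => ?_) (S.integralFunctions s) N
    (fun X hX => ?_) fun X hX h => S.eq_zero_of_forall_coeff (hs X hX) fun μ hμ => ?_
  · funext μ
    change ((μ : S.M) : RingAut Λ)⁻¹ •
        (algebraMap Λ (Frac Λ) d * (X * S.gammaHom γ).coeff μ) =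
      (γ : Λ) • (((μ : S.M) : RingAut Λ)⁻¹ • (algebraMap Λ (Frac Λ) d * X.coeff μ))
    rw [gammaHom_apply, coeff_mul_coeffHom, Algebra.smul_def, ← mul_assoc, smul_mul', mul_comm]
    congr 1
    exact inv_smul_smul ((μ : S.M) : RingAut Λ) _
  · choose b hb using fun μ : s => hds X (hN X hX) (hs X hX) μ μ.2
    refine ⟨fun μ => ((μ : S.M) : RingAut Λ)⁻¹ (b μ), funext fun μ => ?_⟩
    change _ = ((μ : S.M) : RingAut Λ)⁻¹ • (algebraMap Λ (Frac Λ) d * X.coeff μ)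
    rw [hb, smul_algebraMap_frac]; rfl
  · have h1 : ((μ : S.M) : RingAut Λ)⁻¹ • (algebraMap Λ (Frac Λ) d * X.coeff μ) = 0 :=
      congrFun h ⟨μ, hμ⟩
    rw [smul_eq_zero_iff_eq] at h1
    exact (mul_eq_zero.1 h1).resolve_left hd'

/-- The elements of `L ∗ M` supported in `s`. -/
def supported (s : Finset S.M) : AddSubgroup S.𝓛 where
  carrier := {X | ∀ μ, μ ∉ s → X.coeff μ = 0}
  zero_mem' _ _ := rfl
  add_mem' hX hY μ hμ := by simp [hX μ hμ, hY μ hμ]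
  neg_mem' hX μ hμ := by simp [hX μ hμ]

lemma mem_supported {s : Finset S.M} {X : S.𝓛} : X ∈ S.supported s ↔ X.support ⊆ s :=
  ⟨fun h μ hμ => by_contra fun hμs => SkewMonoidAlgebra.mem_support_iff.1 hμ (h μ hμs),
    fun h _ hμ => SkewMonoidAlgebra.notMem_support_iff.1 fun hμ' => hμ (h hμ')⟩

lemma coeffHom_mul_mem_supported {s : Finset S.M} {X : S.𝓛} (hX : X ∈ S.supported s)
    (a : Frac Λ) : S.coeffHom a * X ∈ S.supported s := fun μ hμ => by
  rw [coeff_coeffHom_mul, hX μ hμ, mul_zero]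

lemma mul_coeffHom_mem_supported {s : Finset S.M} {X : S.𝓛} (hX : X ∈ S.supported s)
    (a : Frac Λ) : X * S.coeffHom a ∈ S.supported s := fun μ hμ => by
  rw [coeff_mul_coeffHom, hX μ hμ, zero_mul]

lemma ΓSub_le_KSub : S.ΓSub ≤ S.KSub := by
  rintro _ ⟨γ, rfl⟩
  exact ⟨_, fun g => S.smul_algebraMap_of_mem_Γ g γ.2, rfl⟩

/-- Multiplication by K does not enlarge supports, so the supports of finitely many generators bound
those of all of `W`. -/
lemma isLeftGaloisOrder {U : Subring S.𝓛} (hgr : S.IsGaloisRing U) (hU : U ≤ S.standard) :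
    S.IsLeftGaloisOrder U := by
  classical
  refine ⟨hgr, fun W _ hW => ?_⟩
  obtain ⟨t, rfl⟩ := hW
  let N : Submodule S.ΓSub S.𝓛 :=
    { carrier := {X | X ∈ Submodule.span S.KSub (t : Set S.𝓛) ∧ X ∈ U}
      add_mem' := fun hX hY => ⟨add_mem hX.1 hY.1, add_mem hX.2 hY.2⟩
      zero_mem' := ⟨zero_mem _, zero_mem _⟩
      smul_mem' := fun γ X hX =>
        ⟨Submodule.smul_mem _ (⟨γ, S.ΓSub_le_KSub γ.2⟩ : S.KSub) hX.1,
          mul_mem (hgr.Γ_le γ.2) hX.2⟩ }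
  refine ⟨N, rfl, S.fg_left (fun X hX => hU hX.2) (s := t.biUnion fun X => X.support)
    fun X hX => S.mem_supported.1 ?_⟩
  refine Submodule.span_induction (fun Y hY => ?_) (zero_mem _) (fun _ _ _ _ => add_mem) ?_ hX.1
  · exact S.mem_supported.2 (Finset.subset_biUnion_of_mem (fun X : S.𝓛 => X.support) hY)
  · rintro ⟨_, c, -, rfl⟩ Y - hY
    exact S.coeffHom_mul_mem_supported hY c

lemma isRightGaloisOrder {U : Subring S.𝓛} (hgr : S.IsGaloisRing U) (hU : U ≤ S.standard) :
    S.IsRightGaloisOrder U := by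
  classical
  refine ⟨hgr, fun W _ hW => ?_⟩
  obtain ⟨t, rfl⟩ := hW
  let N : Submodule S.ΓSub.op S.𝓛 :=
    { carrier := {X | X ∈ Submodule.span S.KSub.op (t : Set S.𝓛) ∧ X ∈ U}
      add_mem' := fun hX hY => ⟨add_mem hX.1 hY.1, add_mem hX.2 hY.2⟩
      zero_mem' := ⟨zero_mem _, zero_mem _⟩
      smul_mem' := fun γ X hX =>
        ⟨Submodule.smul_mem _ (⟨γ, S.ΓSub_le_KSub γ.2⟩ : S.KSub.op) hX.1,
          mul_mem hX.2 (hgr.Γ_le γ.2)⟩ }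
  refine ⟨N, rfl, S.fg_right (fun X hX => hU hX.2) (s := t.biUnion fun X => X.support)
    fun X hX => S.mem_supported.1 ?_⟩
  refine Submodule.span_induction (fun Y hY => ?_) (zero_mem _) (fun _ _ _ _ => add_mem) ?_ hX.1
  · exact S.mem_supported.2 (Finset.subset_biUnion_of_mem (fun X : S.𝓛 => X.support) hY)
  · intro a Y _ hY
    obtain ⟨c, -, hc⟩ := a.2
    have : a • Y = Y * S.coeffHom c := congrArg (Y * ·) hc.symm
    rw [this]
    exact S.mul_coeffHom_mem_supported hY c

/-! ### Maximal commutativity. -/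

/-- An element of `𝒦_Γ` commuting with `Γ` lies in `Γ`. -/
lemma mem_ΓSub_of_commute {X : S.𝓛} (hX : X ∈ S.standard)
    (h : ∀ γ : S.Γ, S.gammaHom γ * X = X * S.gammaHom γ) : X ∈ S.ΓSub := by
  -- Comparing μ-coefficients gives γ x_μ = x_μ μ(γ), so μ is trivial on Γ.
  have h1 : ∀ μ ∈ X.support, μ = 1 := fun μ hμ => S.M_ext fun γ hγ => by
    have h2 : (S.gammaHom ⟨γ, hγ⟩ * X).coeff μ = (X * S.gammaHom ⟨γ, hγ⟩).coeff μ := by rw [h]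
    rw [gammaHom_apply, coeff_coeffHom_mul, coeff_mul_coeffHom, mul_comm,
      smul_algebraMap_of_mem_M] at h2
    exact (IsFractionRing.injective Λ (Frac Λ)
      (mul_left_cancel₀ (SkewMonoidAlgebra.mem_support_iff.1 hμ) h2)).symm
  obtain ⟨γ, hγ, hγ'⟩ := hX.2 1 (one_mem _)
  have h3 : X.support ⊆ {1} := fun μ hμ => Finset.mem_singleton.2 (h1 μ hμ)
  rw [S.eval_eq_sum h3, Finset.sum_singleton, map_one (algebraMap Λ (Frac Λ)),
    one_smul, mul_one] at hγ'
  refine ⟨⟨γ, hγ⟩, ?_⟩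
  classical
  ext μ
  rw [gammaHom_apply, ← hγ']
  change (SkewMonoidAlgebra.single 1 (X.coeff 1)).coeff μ = _
  rw [SkewMonoidAlgebra.coeff_single_apply]
  split_ifs with hμ
  · rw [hμ]
  · exact (SkewMonoidAlgebra.notMem_support_iff.1 fun hμ' => hμ (h1 μ hμ').symm).symm

lemma isMaximalCommutative_ΓSub {U : Subring S.𝓛} (hΓU : S.ΓSub ≤ U) (hU : U ≤ S.standard) :
    IsMaximalCommutative S.ΓSub U := by
  refine ⟨hΓU, ?_, fun D hD hcomm hΓD => le_antisymm (fun X hX => ?_) hΓD⟩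
  · rintro _ ⟨γ, rfl⟩ _ ⟨γ', rfl⟩
    rw [← map_mul, ← map_mul, mul_comm]
  · exact S.mem_ΓSub_of_commute (hU (hD hX)) fun γ => hcomm _ (hΓD ⟨γ, rfl⟩) _ hX

/-! ### Local finiteness of Γ on functionals ξX. -/

variable (k : Type v) [Field k] [Algebra k Λ] [S.ActsLinearly k]

lemma gammaHom_mem_standard (γ : S.Γ) : S.gammaHom γ ∈ S.standard :=
  S.ΓSub_le_standard ⟨γ, rfl⟩

lemma evalΓLinear_gammaHom (γ γ' : S.Γ) :
    S.evalΓLinear k ⟨S.gammaHom γ, S.gammaHom_mem_standard γ⟩ γ' = γ * γ' := by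
  apply Subtype.ext
  apply IsFractionRing.injective Λ (Frac Λ)
  change algebraMap Λ (Frac Λ) (S.evalΓ _ γ') = _
  rw [algebraMap_evalΓ, eval_gammaHom, Subring.coe_mul, map_mul]

/-- For a functional `τ` on `Γ`, the map `γ ↦ τ γ = (γ' ↦ τ (γ γ'))`. -/
def orbitMap (τ : Module.Dual k S.Γ) : S.Γ →ₗ[k] Module.Dual k S.Γ :=
  (LinearMap.mul k S.Γ).compr₂ τ

omit [IsDomain Λ] in
lemma orbitMap_apply (τ : Module.Dual k S.Γ) (γ γ' : S.Γ) :
    S.orbitMap k τ γ γ' = τ (γ * γ') := rfl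

/-- The functional `ξ X`. -/
def charMul (ξ : S.Γ →ₐ[k] k) (X : S.standard) : Module.Dual k S.Γ :=
  ξ.toLinearMap.comp (S.evalΓLinear k X)

lemma charMul_apply (ξ : S.Γ →ₐ[k] k) (X : S.standard) (γ : S.Γ) :
    S.charMul k ξ X γ = ξ (S.evalΓLinear k X γ) := rfl

lemma charMul_add (ξ : S.Γ →ₐ[k] k) (X Y : S.standard) :
    S.charMul k ξ (X + Y) = S.charMul k ξ X + S.charMul k ξ Y := by
  rw [charMul, evalΓLinear_add, LinearMap.comp_add]; rfl

lemma charMul_zero (ξ : S.Γ →ₐ[k] k) : S.charMul k ξ 0 = 0 := by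
  rw [charMul, evalΓLinear_zero, LinearMap.comp_zero]

lemma charMul_gammaHom_mul (ξ : S.Γ →ₐ[k] k) (γ : S.Γ) (X : S.standard) :
    S.charMul k ξ (⟨S.gammaHom γ, S.gammaHom_mem_standard γ⟩ * X) = ξ γ • S.charMul k ξ X := by
  ext γ'
  rw [charMul, evalΓLinear_mul]
  change ξ (S.evalΓLinear k _ (S.evalΓLinear k X γ')) = ξ γ * ξ (S.evalΓLinear k X γ')
  rw [evalΓLinear_gammaHom, map_mul]

lemma orbitMap_charMul (ξ : S.Γ →ₐ[k] k) (X : S.standard) (γ : S.Γ) :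
    S.orbitMap k (S.charMul k ξ X) γ =
      S.charMul k ξ (X * ⟨S.gammaHom γ, S.gammaHom_mem_standard γ⟩) := by
  ext γ'
  rw [orbitMap_apply, charMul_apply, charMul_apply, evalΓLinear_mul]
  change _ = ξ (S.evalΓLinear k X (S.evalΓLinear k _ γ'))
  rw [evalΓLinear_gammaHom]

/-- `Γ` acts locally finitely on `ξ 𝒦_Γ`. -/
lemma finiteDimensional_range_orbitMap (ξ : S.Γ →ₐ[k] k) (X : S.standard) :
    FiniteDimensional k (LinearMap.range (S.orbitMap k (S.charMul k ξ X))) := by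
  -- `N` is ΓXΓ. It lies in 𝒦_Γ with supports in Supp X, hence is finitely generated on the left; as
  -- ξγY = ξ(γ)·ξY, finitely many ξY span the image.
  let N : Submodule S.ΓSub S.𝓛 :=
    Submodule.span S.ΓSub (Set.range fun γ : S.Γ => (X : S.𝓛) * S.gammaHom γ)
  have hsmul : ∀ (γ : S.ΓSub) (Y : S.𝓛), Y ∈ S.standard → γ • Y ∈ S.standard :=
    fun γ Y hY => mul_mem (S.ΓSub_le_standard γ.2) hY
  have hN : ∀ Y ∈ N, Y ∈ S.standard := fun Y hY => by
    refine Submodule.span_induction ?_ (zero_mem _) (fun _ _ _ _ => add_mem)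
      (fun γ Y _ => hsmul γ Y) hY
    rintro _ ⟨γ, rfl⟩
    exact mul_mem X.2 (S.gammaHom_mem_standard γ)
  have hs : ∀ Y ∈ N, Y.support ⊆ (X : S.𝓛).support := fun Y hY => by
    refine S.mem_supported.1 (Submodule.span_induction ?_ (zero_mem _) (fun _ _ _ _ => add_mem)
      ?_ hY)
    · rintro _ ⟨γ, rfl⟩
      exact S.mul_coeffHom_mem_supported (S.mem_supported.2 subset_rfl) _
    · rintro ⟨_, γ, rfl⟩ Y - h
      exact S.coeffHom_mul_mem_supported h _
  obtain ⟨t, ht⟩ := S.fg_left hN hs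
  have htS : ∀ Y ∈ t, Y ∈ S.standard := fun Y hY => hN Y (ht ▸ Submodule.subset_span hY)
  let F : t → Module.Dual k S.Γ := fun Y => S.charMul k ξ ⟨Y, htS Y Y.2⟩
  have key : ∀ Y ∈ N, ∃ hY : Y ∈ S.standard,
      S.charMul k ξ ⟨Y, hY⟩ ∈ Submodule.span k (Set.range F) := fun Y hY => by
    rw [← ht] at hY
    induction hY using Submodule.span_induction with
    | mem Y hY => exact ⟨htS Y hY, Submodule.subset_span ⟨⟨Y, hY⟩, rfl⟩⟩
    | zero => exact ⟨zero_mem _, (S.charMul_zero k ξ).symm ▸ zero_mem _⟩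
    | add Y Z _ _ h h' =>
      obtain ⟨hY, hY'⟩ := h
      obtain ⟨hZ, hZ'⟩ := h'
      exact ⟨add_mem hY hZ, (S.charMul_add k ξ ⟨Y, hY⟩ ⟨Z, hZ⟩).symm ▸ add_mem hY' hZ'⟩
    | smul γ Y _ h =>
      obtain ⟨hY, hY'⟩ := h
      refine ⟨hsmul γ Y hY, ?_⟩
      obtain ⟨_, γ, rfl⟩ := γ
      exact (S.charMul_gammaHom_mul k ξ γ ⟨Y, hY⟩).symm ▸ Submodule.smul_mem _ _ hY'
  have hfin : FiniteDimensional k (Submodule.span k (Set.range F)) :=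
    FiniteDimensional.span_of_finite k (Set.finite_range F)
  refine Submodule.finiteDimensional_of_le (S₂ := Submodule.span k (Set.range F)) ?_
  rintro _ ⟨γ, rfl⟩
  rw [orbitMap_charMul]
  exact (key _ (Submodule.subset_span ⟨γ, rfl⟩)).2

/-! ### The cyclic module ξU and its simple quotient. -/

variable {U : Subring S.𝓛} (hU : U ≤ S.standard) (hΓ : S.ΓSub ≤ U) (ξ : S.Γ →ₐ[k] k)

lemma toU_smul (γ : S.Γ) (τ : S.DualΓ k U hU) :
    ((op (S.toU hΓ γ) : Uᵐᵒᵖ) • τ : S.DualΓ k U hU) =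
      S.orbitMap k (show Module.Dual k S.Γ from τ) γ := by
  refine LinearMap.ext fun γ' => ?_
  rw [orbitMap_apply, ← evalΓLinear_gammaHom S k]
  rfl

/-- The generator `ξ` of `ξ U`. -/
def generator : S.cyclicModule k hU ξ :=
  ⟨(show S.DualΓ k U hU from ξ.toLinearMap), Submodule.subset_span rfl⟩

lemma exists_eq_charMul (v : S.cyclicModule k hU ξ) :
    ∃ X : S.standard, (show Module.Dual k S.Γ from (v : S.DualΓ k U hU)) = S.charMul k ξ X := by
  obtain ⟨x, hx⟩ := Submodule.mem_span_singleton.1 v.2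
  exact ⟨⟨_, hU (unop x).2⟩, hx.symm⟩

lemma generator_mem_iff {N : Submodule Uᵐᵒᵖ (S.cyclicModule k hU ξ)} :
    S.generator k hU ξ ∈ N ↔ N = ⊤ := by
  refine ⟨fun h => Submodule.eq_top_iff'.2 fun v => ?_, fun h => h ▸ Submodule.mem_top⟩
  obtain ⟨x, hx⟩ := Submodule.mem_span_singleton.1 v.2
  have : v = x • S.generator k hU ξ := Subtype.ext hx.symm
  exact this ▸ N.smul_mem x h

lemma toU_smul_generator {γ : S.Γ} (hγ : γ ∈ RingHom.ker ξ) :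
    (op (S.toU hΓ γ) : Uᵐᵒᵖ) • S.generator k hU ξ = 0 := by
  apply Subtype.ext
  refine (S.toU_smul k hU hΓ γ _).trans (LinearMap.ext fun γ' => ?_)
  change ξ (γ * γ') = 0
  rw [map_mul, (RingHom.mem_ker).1 hγ, zero_mul]

lemma toU_mul_smul {V : Type*} [AddCommGroup V] [Module Uᵐᵒᵖ V] (γ γ' : S.Γ) (v : V) :
    (op (S.toU hΓ (γ * γ')) : Uᵐᵒᵖ) • v =
      (op (S.toU hΓ γ) : Uᵐᵒᵖ) • (op (S.toU hΓ γ') : Uᵐᵒᵖ) • v := by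
  rw [mul_comm, map_mul, op_mul, mul_smul]

/-- A vector of weight `ξ` is a multiple of `ξ`. -/
lemma generator_mem_of_weight {N : Submodule Uᵐᵒᵖ (S.cyclicModule k hU ξ)}
    {v : S.cyclicModule k hU ξ} (hv : v ∈ N) (hv0 : v ≠ 0)
    (h : ∀ γ ∈ RingHom.ker ξ, (op (S.toU hΓ γ) : Uᵐᵒᵖ) • v = 0) :
    S.generator k hU ξ ∈ N := by
  let τ : Module.Dual k S.Γ := (v : S.DualΓ k U hU)
  -- γ − ξ(γ) lies in ker ξ and so kills τ; evaluate at 1.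
  have hτ : ∀ γ, τ γ = τ 1 * ξ γ := fun γ => by
    have h1 : γ - algebraMap k S.Γ (ξ γ) ∈ RingHom.ker ξ := by
      rw [RingHom.mem_ker, map_sub, AlgHom.commutes]
      exact sub_self _
    have h2 : S.orbitMap k τ (γ - algebraMap k S.Γ (ξ γ)) = 0 :=
      (S.toU_smul k hU hΓ _ _).symm.trans (congrArg Subtype.val (h _ h1))
    have h3 := LinearMap.congr_fun h2 1
    rw [orbitMap_apply, mul_one, map_sub, Algebra.algebraMap_eq_smul_one, map_smul,
      LinearMap.zero_apply, sub_eq_zero, smul_eq_mul, mul_comm] at h3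
    exact h3
  have hτ1 : τ 1 ≠ 0 := fun h0 => hv0 (Subtype.ext (LinearMap.ext fun γ =>
    (hτ γ).trans (by rw [h0, zero_mul]; rfl)))
  have : S.generator k hU ξ = (op (S.toU hΓ (algebraMap k S.Γ (τ 1)⁻¹)) : Uᵐᵒᵖ) • v := by
    apply Subtype.ext
    refine LinearMap.ext fun γ => Eq.symm ?_
    refine (LinearMap.congr_fun (S.toU_smul k hU hΓ _ _) γ).trans ?_
    change τ (algebraMap k S.Γ (τ 1)⁻¹ * γ) = ξ γ
    rw [hτ, map_mul, AlgHom.commutes]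
    change τ 1 * ((τ 1)⁻¹ * ξ γ) = ξ γ
    rw [mul_inv_cancel_left₀ hτ1]
  exact this ▸ N.smul_mem _ hv

/-- Each vector of a proper submodule of `ξ U` is killed by some `γ ∈ Γ` with `ξ γ ≠ 0`. -/
lemma exists_smul_eq_zero_of_mem {N : Submodule Uᵐᵒᵖ (S.cyclicModule k hU ξ)} (hN : N ≠ ⊤)
    {v : S.cyclicModule k hU ξ} (hv : v ∈ N) :
    ∃ γ : S.Γ, ξ γ ≠ 0 ∧ (op (S.toU hΓ γ) : Uᵐᵒᵖ) • v = 0 := by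
  by_contra! hcon
  let τ : Module.Dual k S.Γ := (v : S.DualΓ k U hU)
  have hsmul : ∀ γ : S.Γ, (op (S.toU hΓ γ) : Uᵐᵒᵖ) • v = 0 ↔ S.orbitMap k τ γ = 0 := fun γ =>
    ⟨fun h => (S.toU_smul k hU hΓ _ _).symm.trans (congrArg Subtype.val h),
      fun h => Subtype.ext ((S.toU_smul k hU hΓ _ _).trans h)⟩
  let J : Ideal S.Γ :=
    { carrier := {γ | (op (S.toU hΓ γ) : Uᵐᵒᵖ) • v = 0}
      add_mem' := fun {a b} ha hb => by
        change (op (S.toU hΓ (a + b)) : Uᵐᵒᵖ) • v = 0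
        rw [map_add, op_add, add_smul, show _ • v = 0 from ha, show _ • v = 0 from hb, add_zero]
      zero_mem' := by
        change (op (S.toU hΓ 0) : Uᵐᵒᵖ) • v = 0
        rw [map_zero, op_zero, zero_smul]
      smul_mem' := fun c a ha => by
        change (op (S.toU hΓ (c * a)) : Uᵐᵒᵖ) • v = 0
        exact (S.toU_mul_smul hΓ c a v).trans
          ((congrArg _ (show (op (S.toU hΓ a) : Uᵐᵒᵖ) • v = 0 from ha)).trans (smul_zero _)) }
  have hJ : J ≤ RingHom.ker ξ := fun γ hγ => by
    by_contra h
    exact hcon γ h hγ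
  -- Γ/J is isomorphic to vΓ, which is finite-dimensional because v = ξX for some X.
  have hfin : FiniteDimensional k (S.Γ ⧸ J) := by
    obtain ⟨X, hX⟩ := S.exists_eq_charMul k hU ξ v
    have hX' : τ = S.charMul k ξ X := hX
    have := S.finiteDimensional_range_orbitMap k ξ X
    rw [← hX'] at this
    have hker : J.restrictScalars k = LinearMap.ker (S.orbitMap k τ) := by
      ext γ
      exact hsmul γ
    let e : (S.Γ ⧸ J) ≃ₗ[k] (S.Γ ⧸ LinearMap.ker (S.orbitMap k τ)) :=
      (Submodule.Quotient.restrictScalarsEquiv k J).symm.trans (Submodule.quotEquivOfEq _ _ hker)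
    exact Module.Finite.equiv (e.trans (S.orbitMap k τ).quotKerEquivRange).symm
  have : (RingHom.ker ξ).IsPrime := RingHom.ker_isPrime ξ
  -- vγ is a nonzero vector of `N` killed by ker ξ, hence a multiple of the generator, so `N` is
  -- everything.
  obtain ⟨γ, hγ, hγ'⟩ := exists_notMem_forall_mul_mem (k := k) hJ
  refine hN ((S.generator_mem_iff k hU ξ).1 (S.generator_mem_of_weight k hU hΓ ξ
    (N.smul_mem (op (S.toU hΓ γ)) hv) hγ fun γ' h => ?_))
  rw [← toU_mul_smul]
  exact hγ' γ' h

/-- Being killed by some γ with ξ(γ) ≠ 0 passes to sums: use the product of the two γ's. The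
generator is not killed by such a γ, since (ξγ)(1) = ξ(γ). -/
lemma properSum_ne_top (hΓ : S.ΓSub ≤ U) : S.properSum k hU ξ ≠ ⊤ := fun htop => by
  have key : ∀ v ∈ S.properSum k hU ξ,
      ∃ γ : S.Γ, ξ γ ≠ 0 ∧ (op (S.toU hΓ γ) : Uᵐᵒᵖ) • v = 0 := fun v hv => by
    rw [properSum, sSup_eq_iSup'] at hv
    induction hv using Submodule.iSup_induction' with
    | mem N v hv => exact S.exists_smul_eq_zero_of_mem k hU hΓ ξ N.2 hv
    | zero => exact ⟨1, by simp, smul_zero _⟩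
    | add v w _ _ h h' =>
      obtain ⟨γ, h1, h2⟩ := h
      obtain ⟨γ', h1', h2'⟩ := h'
      refine ⟨γ * γ', by rw [map_mul]; exact mul_ne_zero h1 h1', ?_⟩
      rw [smul_add, S.toU_mul_smul hΓ γ γ' w, h2', smul_zero, add_zero, mul_comm, toU_mul_smul, h2,
        smul_zero]
  obtain ⟨γ, hγ, h⟩ := key _ ((S.generator_mem_iff k hU ξ).2 htop)
  have h1 : S.orbitMap k ξ.toLinearMap γ = 0 :=
    (S.toU_smul k hU hΓ _ _).symm.trans (congrArg Subtype.val h)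
  have h2 : ξ (γ * 1) = 0 := LinearMap.congr_fun h1 1
  exact hγ (by rwa [mul_one] at h2)

lemma isCoatom_properSum (hΓ : S.ΓSub ≤ U) : IsCoatom (S.properSum k hU ξ) :=
  ⟨S.properSum_ne_top k hU ξ hΓ, fun N hN => by
    by_contra h
    exact hN.not_ge (le_sSup h)⟩

lemma eq_properSum_of_isCoatom {N : Submodule Uᵐᵒᵖ (S.cyclicModule k hU ξ)} (hN : IsCoatom N)
    (hΓ : S.ΓSub ≤ U) : N = S.properSum k hU ξ :=
  ((hN.le_iff).1 (le_sSup hN.1)).resolve_left (S.properSum_ne_top k hU ξ hΓ) |>.symm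

/-- Local finiteness passes to quotients: γ ↦ vγ factors through the orbit map of a lift ξX of v,
whose range is finite-dimensional. -/
lemma isGelfandZeitlin_V : S.IsGelfandZeitlin k hΓ (S.V k hU ξ) := by
  let instV : Module k (S.V k hU ξ) := Module.compHom _ (S.scalarHom k hΓ)
  intro v
  obtain ⟨w, rfl⟩ := Submodule.mkQ_surjective _ v
  let h : S.Γ →ₗ[k] S.V k hU ξ :=
    { toFun := fun γ => (op (S.toU hΓ γ) : Uᵐᵒᵖ) • (S.properSum k hU ξ).mkQ w
      map_add' := fun a b => by rw [map_add, op_add, add_smul]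
      map_smul' := fun c a => by
        rw [Algebra.smul_def, toU_mul_smul]; rfl }
  obtain ⟨X, hX⟩ := S.exists_eq_charMul k hU ξ w
  have hfin := S.finiteDimensional_range_orbitMap k ξ X
  have hker : LinearMap.ker (S.orbitMap k (S.charMul k ξ X)) ≤ LinearMap.ker h := fun γ hγ => by
    have h1 : (op (S.toU hΓ γ) : Uᵐᵒᵖ) • w = 0 := by
      apply Subtype.ext
      refine (S.toU_smul k hU hΓ _ _).trans ?_
      rw [← hX] at hγ
      exact hγ
    change (op (S.toU hΓ γ) : Uᵐᵒᵖ) • (S.properSum k hU ξ).mkQ w = 0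
    rw [← map_smul, h1, map_zero]
  have hq := Module.Finite.equiv (S.orbitMap k (S.charMul k ξ X)).quotKerEquivRange.symm
  have hr : FiniteDimensional k (LinearMap.range h) := by
    rw [← Submodule.range_liftQ _ h hker]
    infer_instance
  have hspan : Submodule.span k (Set.range h) = LinearMap.range h := by
    rw [← LinearMap.coe_range, Submodule.span_eq]
  rw [← hspan] at hr
  exact hr

lemma exists_mem_weightSpace_V : ∃ v ∈ S.weightSpace hΓ (S.V k hU ξ) ξ, v ≠ 0 := by
  -- The first power of ker ξ already kills ξ, so N₀ = 1; the class of ξ is nonzero because ξ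
  -- generates and `properSum` is proper.
  refine ⟨(S.properSum k hU ξ).mkQ (S.generator k hU ξ), ⟨1, fun N hN γ hγ => ?_⟩, fun h => ?_⟩
  · rw [← map_smul, S.toU_smul_generator k hU hΓ ξ (Ideal.pow_le_self (by omega) hγ), map_zero]
  · rw [Submodule.mkQ_apply, Submodule.Quotient.mk_eq_zero] at h
    exact S.properSum_ne_top k hU ξ hΓ ((S.generator_mem_iff k hU ξ).1 h)

end Datum

end GaloisOrder

end

theorem theorem1 {Λ : Type*} [CommRing Λ] [IsDomain Λ] [IsIntegrallyClosed Λ]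
    (S : GaloisOrder.Datum Λ) (𝒳 : Set S.𝓛) (h𝒦 : 𝒳 ⊆ S.𝒦)
    (hsupp : Submonoid.closure (⋃ X ∈ 𝒳, (X.support : Set S.M)) = ⊤)
    (hΓ : ∀ X ∈ 𝒳, S.PreservesΓ X) :
    S.IsGaloisOrder (S.generated 𝒳) ∧
    GaloisOrder.IsMaximalCommutative S.ΓSub (S.generated 𝒳) ∧
    ∀ (k : Type*) [Field k] [IsAlgClosed k] [CharZero k] [Algebra k Λ] [Algebra.FiniteType k Λ]
      [S.ActsLinearly k] (ξ : S.Γ →ₐ[k] k),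
      IsSimpleModule (S.generated 𝒳)ᵐᵒᵖ (S.V k (S.generated_le_standard h𝒦 hΓ) ξ) ∧
      (∀ N : Submodule (S.generated 𝒳)ᵐᵒᵖ
          (S.cyclicModule k (S.generated_le_standard h𝒦 hΓ) ξ),
        IsSimpleModule (S.generated 𝒳)ᵐᵒᵖ
          (S.cyclicModule k (S.generated_le_standard h𝒦 hΓ) ξ ⧸ N) →
        N = S.properSum k (S.generated_le_standard h𝒦 hΓ) ξ) ∧
      S.IsGelfandZeitlin k (S.Γ_le_generated 𝒳)
        (S.V k (S.generated_le_standard h𝒦 hΓ) ξ) ∧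
      ∃ v ∈ S.weightSpace (S.Γ_le_generated 𝒳)
        (S.V k (S.generated_le_standard h𝒦 hΓ) ξ) ξ, v ≠ 0 := by
  have hU := S.generated_le_standard h𝒦 hΓ
  have hle := S.Γ_le_generated 𝒳
  have hgr := S.isGaloisRing hle (fun X hX => (hU hX).1) (S.supportMonoid_generated hsupp)
  refine ⟨⟨S.isLeftGaloisOrder hgr hU, S.isRightGaloisOrder hgr hU⟩,
    S.isMaximalCommutative_ΓSub hle hU, ?_⟩
  intro k _ _ _ _ _ _ ξ
  exact ⟨isSimpleModule_iff_isCoatom.2 (S.isCoatom_properSum k hU ξ hle),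
    fun N hN => S.eq_properSum_of_isCoatom k hU ξ (isSimpleModule_iff_isCoatom.1 hN) hle,
    S.isGelfandZeitlin_V k hU hle ξ, S.exists_mem_weightSpace_V k hU hle ξ⟩
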